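/- Let $p$ be a prime, $q$ a power of $p$, and let $\mathbb{F}_q(t)\langle\partial\rangle$ be the ring of linear differential operators $\sum_i f_i\partial^i$ ($f_i\in\mathbb{F}_q(t)$), with multiplication determined by $\partial f=f\partial+\frac{\mathrm{d}f}{\mathrm{d}t}$. For an operator $L$ put $\mathcal{D}_L=\mathbb{F}_q(t)\langle\partial\rangle/\mathbb{F}_q(t)\langle\partial\rangle L$ (a left module), let $\psi_p^L$ be the $\mathbb{F}_q(t)$-linear endomorphism $x\mapsto\partial^p x$ of $\mathcal{D}_L$ (the $p$-curvature of $L$), and, for $L\neq 0$, let $\chi(\psi_p^L)$ be its characteristic polynomial, which has coefficients in $\mathbb{F}_q(t^p)$. Call $L$ decomposable if there are $L_1,L_2\in\mathbb{F}_q(t)\langle\partial\rangle\setminus\mathbb{F}_q(t)$ such that $\mathbb{F}_q(t)\langle\partial\rangle L_1+\mathbb{F}_q(t)\langle\partial\rangle L_2=\mathbb{F}_q(t)\langle\partial\rangle$ and $\mathbb{F}_q(t)\langle\partial\rangle L_1\cap\mathbb{F}_q(t)\langle\partial\rangle L_2=\mathbb{F}_q(t)\langle\partial\rangle L$, and indecomposable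 otherwise. Call two operators $L_1,L_2$ equivalent if $\mathcal{D}_{L_1}$ and $\mathcal{D}_{L_2}$ are isomorphic as left $\mathbb{F}_q(t)\langle\partial\rangle$-modules. Let $L_1,L_2\in\mathbb{F}_q(t)\langle\partial\rangle$ be nonzero indecomposable operators such that neither $\chi(\psi_p^{L_1})$ nor $\chi(\psi_p^{L_2})$ has an inseparable irreducible factor over $\mathbb{F}_q(t^p)$. Then $L_1$ and $L_2$ are equivalent if and only if $\chi(\psi_p^{L_1})=\chi(\psi_p^{L_2})$. -/

import Mathlib

noncomputable section

/-! ### The derivation `d/dt` of the rational function field `F(t)` -/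

namespace RatDeriv

variable {F : Type*} [Field F]

/-- The quotient rule `(a / b)' = (a' b - a b') / b ^ 2` for the reduced fraction of `f`. -/
def fn (f : RatFunc F) : RatFunc F :=
  algebraMap (Polynomial F) (RatFunc F)
      (Polynomial.derivative f.num * f.denom - f.num * Polynomial.derivative f.denom) /
    algebraMap (Polynomial F) (RatFunc F) f.denom ^ 2

theorem fn_div (a b : Polynomial F) (hb : b ≠ 0) :
    fn (algebraMap (Polynomial F) (RatFunc F) a / algebraMap (Polynomial F) (RatFunc F) b) =
      algebraMap (Polynomial F) (RatFunc F)
          (Polynomial.derivative a * b - a * Polynomial.derivative b) /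
        algebraMap (Polynomial F) (RatFunc F) b ^ 2 := by
  set f := algebraMap (Polynomial F) (RatFunc F) a / algebraMap (Polynomial F) (RatFunc F) b
    with hf
  have hinj : Function.Injective (algebraMap (Polynomial F) (RatFunc F)) :=
    RatFunc.algebraMap_injective F
  have hd : f.denom ≠ 0 := f.denom_ne_zero
  have hb' : algebraMap (Polynomial F) (RatFunc F) b ≠ 0 := by
    simpa using hb
  have hd' : algebraMap (Polynomial F) (RatFunc F) f.denom ≠ 0 := by
    simpa using hd
  have h1 : f.num * b = a * f.denom := by
    apply hinj
    rw [map_mul, map_mul]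
    have := RatFunc.num_div_denom f
    rw [hf, div_eq_div_iff hd' hb'] at this
    exact this
  have h2 := congrArg Polynomial.derivative h1
  rw [Polynomial.derivative_mul, Polynomial.derivative_mul] at h2
  unfold fn
  rw [div_eq_div_iff (pow_ne_zero _ hd') (pow_ne_zero _ hb'), ← map_pow, ← map_pow, ← map_mul,
    ← map_mul]
  congr 1
  linear_combination (b * f.denom) * h2 - (b * Polynomial.derivative f.denom +
    f.denom * Polynomial.derivative b) * h1

end RatDeriv

/-- The derivation `d/dt` of `F(t)`. -/
def ratDeriv (F : Type*) [Field F] : Derivation F (RatFunc F) (RatFunc F) :=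
  Derivation.mk'
    { toFun := RatDeriv.fn
      map_add' := by
        intro x y
        induction x using RatFunc.induction_on with
        | _ a b hb =>
        induction y using RatFunc.induction_on with
        | _ c d hd =>
        have hb' : algebraMap (Polynomial F) (RatFunc F) b ≠ 0 := by simpa using hb
        have hd' : algebraMap (Polynomial F) (RatFunc F) d ≠ 0 := by simpa using hd
        rw [div_add_div _ _ hb' hd', ← map_mul, ← map_mul, ← map_mul, ← map_add,
          RatDeriv.fn_div _ _ hb, RatDeriv.fn_div _ _ hd, RatDeriv.fn_div _ _ (mul_ne_zero hb hd)]
        simp only [Polynomial.derivative_mul, map_add, map_sub, map_mul]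
        field_simp
        ring
      map_smul' := by
        intro c x
        induction x using RatFunc.induction_on with
        | _ a b hb =>
        rw [Algebra.smul_def, IsScalarTower.algebraMap_apply F (Polynomial F) (RatFunc F),
          ← mul_div_assoc, ← map_mul, RatDeriv.fn_div _ _ hb, RatDeriv.fn_div _ _ hb,
          RingHom.id_apply, Algebra.smul_def,
          IsScalarTower.algebraMap_apply F (Polynomial F) (RatFunc F), ← mul_div_assoc, ← map_mul]
        congr 2
        simp only [Polynomial.algebraMap_eq, Polynomial.derivative_mul, Polynomial.derivative_C]
        ring }
    (by
      intro x y
      induction x using RatFunc.induction_on with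
      | _ a b hb =>
      induction y using RatFunc.induction_on with
      | _ c d hd =>
      have hb' : algebraMap (Polynomial F) (RatFunc F) b ≠ 0 := by simpa using hb
      have hd' : algebraMap (Polynomial F) (RatFunc F) d ≠ 0 := by simpa using hd
      simp only [LinearMap.coe_mk, AddHom.coe_mk, smul_eq_mul]
      rw [div_mul_div_comm, ← map_mul, ← map_mul,
        RatDeriv.fn_div _ _ hb, RatDeriv.fn_div _ _ hd, RatDeriv.fn_div _ _ (mul_ne_zero hb hd)]
      simp only [Polynomial.derivative_mul, map_add, map_sub, map_mul]
      field_simp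
      ring)

theorem ratDeriv_div {F : Type*} [Field F] (a b : Polynomial F) (hb : b ≠ 0) :
    ratDeriv F
        (algebraMap (Polynomial F) (RatFunc F) a / algebraMap (Polynomial F) (RatFunc F) b) =
      algebraMap (Polynomial F) (RatFunc F)
          (Polynomial.derivative a * b - a * Polynomial.derivative b) /
        algebraMap (Polynomial F) (RatFunc F) b ^ 2 :=
  RatDeriv.fn_div a b hb

/-- In characteristic `p` the `p`-th iterate of `d/dt` vanishes. -/
theorem ratDeriv_iterate {F : Type*} [Field F] (p : ℕ) [Fact p.Prime] [CharP F p]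
    (f : RatFunc F) : (ratDeriv F)^[p] f = 0 := by
  induction f using RatFunc.induction_on with
  | _ a b hb =>
  have hp : p ≠ 0 := (Fact.out : p.Prime).ne_zero
  have hb' : algebraMap (Polynomial F) (RatFunc F) b ≠ 0 := by simpa using hb
  have key : ∀ (k : ℕ) (g : Polynomial F),
      (ratDeriv F)^[k] (algebraMap (Polynomial F) (RatFunc F) g /
        algebraMap (Polynomial F) (RatFunc F) (b ^ p)) =
      algebraMap (Polynomial F) (RatFunc F) (Polynomial.derivative^[k] g) /
        algebraMap (Polynomial F) (RatFunc F) (b ^ p) := by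
    intro k
    induction k with
    | zero => intro g; rfl
    | succ k ih =>
      intro g
      have h0 : Polynomial.derivative (b ^ p) = 0 := by
        rw [Polynomial.derivative_pow]
        simp
      rw [Function.iterate_succ_apply, ratDeriv_div _ _ (pow_ne_zero _ hb), h0, mul_zero, sub_zero,
        Function.iterate_succ_apply, ← ih]
      congr 1
      rw [map_mul]
      have : algebraMap (Polynomial F) (RatFunc F) (b ^ p) ≠ 0 := by
        rw [map_pow]; exact pow_ne_zero _ hb'
      field_simp
  have h1 : algebraMap (Polynomial F) (RatFunc F) a / algebraMap (Polynomial F) (RatFunc F) b =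
      algebraMap (Polynomial F) (RatFunc F) (a * b ^ (p - 1)) /
        algebraMap (Polynomial F) (RatFunc F) (b ^ p) := by
    obtain ⟨m, rfl⟩ := Nat.exists_eq_succ_of_ne_zero hp
    rw [Nat.succ_sub_one, map_mul, map_pow, map_pow, pow_succ]
    field_simp
  rw [h1, key, ← Polynomial.factorial_smul_hasseDeriv]
  have h2 : ((p.factorial : ℕ) : Polynomial F) = 0 := by
    rw [CharP.cast_eq_zero_iff (Polynomial F) p]
    exact Nat.dvd_factorial (Nat.pos_of_ne_zero hp) le_rfl
  rw [LinearMap.smul_apply, nsmul_eq_mul, h2, zero_mul, map_zero, zero_div]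

/-! ### The ring `F(t)⟨∂⟩` of linear differential operators -/

/-- A differential operator `∑ aᵢ ∂ⁱ` with `aᵢ ∈ F(t)`, given by its coefficients. -/
@[ext]
structure DiffOp (F : Type*) [Field F] where
  /-- The coefficients `i ↦ aᵢ`. -/
  coeff : ℕ →₀ RatFunc F

namespace DiffOp

variable {F : Type*} [Field F]

/-- An operator is the same thing as its finitely supported family of coefficients. -/
def coeffEquiv (F : Type*) [Field F] : DiffOp F ≃ (ℕ →₀ RatFunc F) where
  toFun := coeff
  invFun := mk
  left_inv _ := rfl
  right_inv _ := rfl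

/-- Addition is coefficientwise. -/
instance : AddCommGroup (DiffOp F) := (coeffEquiv F).addCommGroup

/-- Scalar multiplication by `F(t)` on the left is coefficientwise. -/
instance : Module (RatFunc F) (DiffOp F) := (coeffEquiv F).module (RatFunc F)

/-- The coefficients, as a linear map. -/
def coeffLinear (F : Type*) [Field F] : DiffOp F ≃ₗ[RatFunc F] (ℕ →₀ RatFunc F) :=
  (coeffEquiv F).linearEquiv (RatFunc F)

/-- The monomial `a ∂ⁱ`. -/
def mono (i : ℕ) : RatFunc F →ₗ[RatFunc F] DiffOp F :=
  (coeffLinear F).symm.toLinearMap ∘ₗ Finsupp.lsingle i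

theorem coeff_mono (i : ℕ) (a : RatFunc F) : (mono i a).coeff = Finsupp.single i a := rfl

theorem smul_mono (i : ℕ) (a b : RatFunc F) : a • mono i b = mono i (a * b) := by
  rw [← map_smul, smul_eq_mul]

theorem sum_mono (x : DiffOp F) : x = x.coeff.sum fun i a => mono i a := by
  apply (coeffLinear F).injective
  unfold Finsupp.sum
  rw [map_sum]
  exact (Finsupp.sum_single x.coeff).symm

/-- The additive map with prescribed values on the monomials. -/
def lift {M : Type*} [AddCommMonoid M] (f : ℕ → RatFunc F →+ M) : DiffOp F →+ M :=
  (Finsupp.liftAddHom f).comp (coeffLinear F).toLinearMap.toAddMonoidHom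

theorem lift_mono {M : Type*} [AddCommMonoid M] (f : ℕ → RatFunc F →+ M) (i : ℕ)
    (a : RatFunc F) : lift f (mono i a) = f i a :=
  Finsupp.liftAddHom_apply_single f i a

theorem addHom_ext {M : Type*} [AddCommMonoid M] {f g : DiffOp F →+ M}
    (h : ∀ i a, f (mono i a) = g (mono i a)) : f = g := by
  ext x
  rw [sum_mono x]
  unfold Finsupp.sum
  rw [map_sum, map_sum]
  exact Finset.sum_congr rfl fun i _ => h _ _

/-- Left multiplication by `∂`: `∑ aᵢ ∂ⁱ ↦ ∑ (aᵢ' ∂ⁱ + aᵢ ∂ⁱ⁺¹)`. -/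
def dLeft : DiffOp F →+ DiffOp F :=
  lift fun i => (mono i).toAddMonoidHom.comp (ratDeriv F : RatFunc F →+ RatFunc F) +
    (mono (i + 1)).toAddMonoidHom

theorem dLeft_mono (i : ℕ) (a : RatFunc F) :
    dLeft (mono i a) = mono i (ratDeriv F a) + mono (i + 1) a := by
  unfold dLeft
  rw [lift_mono]
  rfl

theorem dLeft_smul (a : RatFunc F) (x : DiffOp F) :
    dLeft (a • x) = ratDeriv F a • x + a • dLeft x := by
  have : (dLeft : DiffOp F →+ DiffOp F).comp (DistribSMul.toAddMonoidHom (DiffOp F) a) =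
      DistribSMul.toAddMonoidHom (DiffOp F) (ratDeriv F a) +
        (DistribSMul.toAddMonoidHom (DiffOp F) a).comp dLeft := by
    refine addHom_ext fun i b => ?_
    simp only [AddMonoidHom.comp_apply, AddMonoidHom.add_apply,
      DistribSMul.toAddMonoidHom_apply]
    rw [smul_mono, dLeft_mono, dLeft_mono, smul_add, smul_mono, smul_mono, smul_mono,
      Derivation.leibniz, smul_eq_mul, smul_eq_mul, map_add, mul_comm b]
    abel
  exact DFunLike.congr_fun this x

/-- Left multiplication by `∂ⁱ`. -/
def dLeftPow : ℕ → DiffOp F →+ DiffOp F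
  | 0 => AddMonoidHom.id _
  | i + 1 => dLeft.comp (dLeftPow i)

/-- Left multiplication by `∑ aᵢ ∂ⁱ`: apply `∂` from the left `i` times, then multiply by `aᵢ`,
and sum over `i`. -/
def mulLeft : DiffOp F →+ (DiffOp F →+ DiffOp F) :=
  lift fun i => AddMonoidHom.mk'
    (fun a => (DistribSMul.toAddMonoidHom (DiffOp F) a).comp (dLeftPow i))
    (fun a b => AddMonoidHom.ext fun _ => add_smul a b _)

instance : Mul (DiffOp F) := ⟨fun x y => mulLeft x y⟩

instance : One (DiffOp F) := ⟨mono 0 1⟩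

theorem mul_def (x y : DiffOp F) : x * y = mulLeft x y := rfl

theorem one_def : (1 : DiffOp F) = mono 0 1 := rfl

theorem mono_mul (i : ℕ) (a : RatFunc F) (y : DiffOp F) :
    mono i a * y = a • dLeftPow i y := by
  rw [mul_def, mulLeft, lift_mono]
  rfl

protected theorem smul_mul (a : RatFunc F) (x y : DiffOp F) : (a • x) * y = a • (x * y) := by
  have : (mulLeft.comp (DistribSMul.toAddMonoidHom (DiffOp F) a)).flip y =
      (DistribSMul.toAddMonoidHom (DiffOp F) a).comp ((mulLeft (F := F)).flip y) := by
    refine addHom_ext fun i b => ?_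
    simp only [AddMonoidHom.comp_apply, AddMonoidHom.flip_apply,
      DistribSMul.toAddMonoidHom_apply, ← mul_def]
    rw [smul_mono, mono_mul, mono_mul, mul_smul]
  exact DFunLike.congr_fun this x

theorem dLeft_mul (x y : DiffOp F) : dLeft x * y = dLeft (x * y) := by
  have : (mulLeft.comp (dLeft : DiffOp F →+ DiffOp F)).flip y =
      (dLeft : DiffOp F →+ DiffOp F).comp ((mulLeft (F := F)).flip y) := by
    refine addHom_ext fun i b => ?_
    simp only [AddMonoidHom.comp_apply, AddMonoidHom.flip_apply]
    rw [dLeft_mono, map_add, AddMonoidHom.add_apply]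
    simp only [← mul_def]
    rw [mono_mul, mono_mul, mono_mul, dLeft_smul]
    rfl
  exact DFunLike.congr_fun this x

theorem dLeftPow_mul (i : ℕ) (x y : DiffOp F) : dLeftPow i x * y = dLeftPow i (x * y) := by
  induction i with
  | zero => rfl
  | succ i ih =>
    simp only [dLeftPow, AddMonoidHom.comp_apply]
    rw [dLeft_mul, ih]

theorem dLeftPow_one (i : ℕ) : dLeftPow i (1 : DiffOp F) = mono i 1 := by
  induction i with
  | zero => rfl
  | succ i ih =>
    simp only [dLeftPow, AddMonoidHom.comp_apply]
    rw [ih, dLeft_mono, Derivation.map_one_eq_zero, map_zero, zero_add]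

protected theorem one_mul' (x : DiffOp F) : 1 * x = x := by
  rw [one_def, mono_mul, one_smul]
  rfl

protected theorem mul_one' (x : DiffOp F) : x * 1 = x := by
  have : (mulLeft (F := F)).flip 1 = AddMonoidHom.id _ := by
    refine addHom_ext fun i b => ?_
    rw [AddMonoidHom.flip_apply, ← mul_def, mono_mul, dLeftPow_one, smul_mono, mul_one]
    rfl
  exact DFunLike.congr_fun this x

protected theorem mul_assoc' (x y z : DiffOp F) : x * y * z = x * (y * z) := by
  have : ((mulLeft (F := F)).flip z).comp ((mulLeft (F := F)).flip y) =
      (mulLeft (F := F)).flip (y * z) := by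
    refine addHom_ext fun i b => ?_
    simp only [AddMonoidHom.comp_apply, AddMonoidHom.flip_apply, ← mul_def]
    rw [mono_mul, mono_mul, DiffOp.smul_mul, dLeftPow_mul]
  exact DFunLike.congr_fun this x

/-- `F(t)⟨∂⟩` is a ring; its multiplication is governed by `∂ f = f ∂ + f'`, see `D_mul_C`. -/
instance : Ring (DiffOp F) :=
  { (inferInstance : AddCommGroup (DiffOp F)), (inferInstance : Mul (DiffOp F)),
    (inferInstance : One (DiffOp F)) with
    left_distrib := fun x y z => map_add (mulLeft x) y z
    right_distrib := fun x y z => by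
      rw [mul_def, map_add]
      rfl
    zero_mul := fun x => by
      rw [mul_def, map_zero]
      rfl
    mul_zero := fun x => map_zero (mulLeft x)
    one_mul := DiffOp.one_mul'
    mul_one := DiffOp.mul_one'
    mul_assoc := DiffOp.mul_assoc' }

instance : IsScalarTower (RatFunc F) (DiffOp F) (DiffOp F) := ⟨DiffOp.smul_mul⟩

/-- The inclusion of `F(t)` in `F(t)⟨∂⟩`, as the operators `a ∂⁰`. -/
def C : RatFunc F →+* DiffOp F where
  toFun := mono 0
  map_zero' := map_zero _
  map_add' := map_add _
  map_one' := rfl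
  map_mul' a b := by
    rw [mono_mul, ← smul_mono]
    rfl

/-- The operator `∂`. -/
def D : DiffOp F := mono 1 1

theorem C_def (a : RatFunc F) : C a = mono 0 a := rfl

theorem smul_eq (a : RatFunc F) (x : DiffOp F) : a • x = C a * x := by
  rw [C_def, mono_mul]
  rfl

theorem D_mul (x : DiffOp F) : D * x = dLeft x := by
  rw [D, mono_mul, one_smul]
  rfl

/-- The commutation rule `∂ f = f ∂ + f'`. -/
theorem D_mul_C (a : RatFunc F) : D * C a = C a * D + C (ratDeriv F a) := by
  rw [D_mul, ← smul_eq, C_def, C_def, D, dLeft_mono, smul_mono, mul_one, add_comm]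

theorem D_pow (i : ℕ) : (D : DiffOp F) ^ i = mono i 1 := by
  induction i with
  | zero => rfl
  | succ i ih =>
    rw [pow_succ', ih, D_mul, dLeft_mono, Derivation.map_one_eq_zero, map_zero, zero_add]

/-- Every operator is the combination `∑ aᵢ ∂ⁱ` of the powers of `∂` given by its
coefficients. -/
theorem eq_sum (x : DiffOp F) : x = x.coeff.sum fun i a => a • (D : DiffOp F) ^ i := by
  simp only [D_pow, smul_mono, mul_one]
  exact sum_mono x

theorem C_injective : Function.Injective (C : RatFunc F →+* DiffOp F) := by
  intro a b h
  exact Finsupp.single_injective 0 (congrArg coeff h)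

/-- In characteristic `p` the operator `∂ᵖ` commutes with `F(t)`. -/
theorem D_pow_char_mul_C (p : ℕ) [Fact p.Prime] [CharP F p] (a : RatFunc F) :
    D ^ p * C a = C a * D ^ p := by
  have : CharP (RatFunc F) p :=
    charP_of_injective_algebraMap (algebraMap F (RatFunc F)).injective p
  have : CharP (DiffOp F) p := charP_of_injective_ringHom C_injective p
  have : CharP (AddMonoid.End (DiffOp F)) p := by
    refine ⟨fun n => ?_⟩
    rw [← CharP.cast_eq_zero_iff (DiffOp F) p]
    constructor
    · intro h
      have := DFunLike.congr_fun h (1 : DiffOp F)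
      simpa using this
    · intro h
      ext1 x
      simp [h]
  have hm : ∀ (f g : AddMonoid.End (DiffOp F)) x, (f * g) x = f (g x) := fun _ _ _ => rfl
  have hs : ∀ (f g : AddMonoid.End (DiffOp F)) x, (f - g) x = f x - g x := fun _ _ _ => rfl
  let l : AddMonoid.End (DiffOp F) := AddMonoidHom.mulLeft D
  let r : AddMonoid.End (DiffOp F) := AddMonoidHom.mulRight D
  have hl1 : ∀ x, l x = D * x := fun _ => rfl
  have hr1 : ∀ x, r x = x * D := fun _ => rfl
  have hc : Commute l r := by
    ext1 x
    rw [hm, hm, hl1, hr1, hl1, hr1, mul_assoc]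
  have h1 := sub_pow_char_of_commute (p := p) hc
  have hl : ∀ (n : ℕ) x, (l ^ n) x = D ^ n * x := by
    intro n
    induction n with
    | zero => intro x; rw [pow_zero, pow_zero, one_mul]; rfl
    | succ n ih =>
      intro x
      rw [pow_succ', hm, ih, hl1, pow_succ', mul_assoc]
  have hr : ∀ (n : ℕ) x, (r ^ n) x = x * D ^ n := by
    intro n
    induction n with
    | zero => intro x; rw [pow_zero, pow_zero, mul_one]; rfl
    | succ n ih =>
      intro x
      rw [pow_succ', hm, ih, hr1, pow_succ, mul_assoc]
  have hd : ∀ (n : ℕ), ((l - r) ^ n) (C a) = C ((ratDeriv F)^[n] a) := by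
    intro n
    induction n with
    | zero => rfl
    | succ n ih =>
      rw [pow_succ', hm, ih, hs, hl1, hr1, D_mul_C,
        add_sub_cancel_left, Function.iterate_succ_apply']
  have h2 := DFunLike.congr_fun h1 (C a)
  rw [hd, ratDeriv_iterate, map_zero] at h2
  rw [hs, hl, hr] at h2
  exact (sub_eq_zero.mp h2.symm)

/-! ### Left ideals, quotient modules, indecomposability -/

/-- The left ideal `F(t)⟨∂⟩ L`. -/
def leftIdeal (L : DiffOp F) : Submodule (DiffOp F) (DiffOp F) := Submodule.span (DiffOp F) {L}

/-- The left `F(t)⟨∂⟩`-module `𝒟_L = F(t)⟨∂⟩ / F(t)⟨∂⟩ L`. It is an `F(t)`-vector space through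
the inclusion of `F(t)` in `F(t)⟨∂⟩`. -/
abbrev QuotMod (L : DiffOp F) : Type _ := DiffOp F ⧸ leftIdeal L

/-- `L` is a least common left multiple of `L₁` and `L₂`. -/
def IsLCLM (L L₁ L₂ : DiffOp F) : Prop := leftIdeal L = leftIdeal L₁ ⊓ leftIdeal L₂

/-- `L` is a greatest common right divisor of `L₁` and `L₂`. -/
def IsGCRD (L L₁ L₂ : DiffOp F) : Prop := leftIdeal L = leftIdeal L₁ ⊔ leftIdeal L₂

/-- `L` is the least common left multiple of two coprime operators, neither of which is
in `F(t)`. -/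
def Decomposable (L : DiffOp F) : Prop :=
  ∃ L₁ L₂ : DiffOp F, L₁ ∉ Set.range (C (F := F)) ∧ L₂ ∉ Set.range (C (F := F)) ∧
    IsGCRD 1 L₁ L₂ ∧ IsLCLM L L₁ L₂

def Indecomposable (L : DiffOp F) : Prop := ¬ Decomposable L

/-- `L₁` and `L₂` are equivalent: `𝒟_{L₁}` and `𝒟_{L₂}` are isomorphic left
`F(t)⟨∂⟩`-modules. -/
def Equivalent (L₁ L₂ : DiffOp F) : Prop := Nonempty (QuotMod L₁ ≃ₗ[DiffOp F] QuotMod L₂)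

/-! ### The `p`-curvature and its characteristic polynomial -/

theorem C_smul_quot {L : DiffOp F} (a : RatFunc F) (x : QuotMod L) : C a • x = a • x := by
  obtain ⟨y, rfl⟩ := Submodule.Quotient.mk_surjective _ x
  rw [← Submodule.Quotient.mk_smul, ← Submodule.Quotient.mk_smul, smul_eq_mul, ← smul_eq]

/-- The `p`-curvature of `L`: the `F(t)`-linear endomorphism `x ↦ ∂ᵖ x` of `𝒟_L`. -/
def pCurvature (p : ℕ) [Fact p.Prime] [CharP F p] (L : DiffOp F) :
    QuotMod L →ₗ[RatFunc F] QuotMod L where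
  toFun x := (D ^ p : DiffOp F) • x
  map_add' := smul_add _
  map_smul' a x := by
    rw [RingHom.id_apply, ← C_smul_quot, ← C_smul_quot, smul_smul, smul_smul, D_pow_char_mul_C]

/-- For `L ≠ 0` the `F(t)`-vector space `𝒟_L` is finite-dimensional. -/
theorem finite_quotMod (L : DiffOp F) (hL : L ≠ 0) : Module.Finite (RatFunc F) (QuotMod L) := by
  classical
  let S : Finset ℕ := L.coeff.support
  have hS : S.Nonempty :=
    Finsupp.support_nonempty_iff.mpr fun h => hL (DiffOp.ext h)
  let n := S.max' hS
  let e : ℕ → QuotMod L := fun i => Submodule.Quotient.mk (D ^ i)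
  let W : Submodule (RatFunc F) (QuotMod L) :=
    Submodule.span (RatFunc F) (e '' (Set.Iio n))
  have hlt : ∀ i, i < n → e i ∈ W := fun i hi => Submodule.subset_span ⟨i, hi, rfl⟩
  have hsum : ∀ x : DiffOp F, (Submodule.Quotient.mk x : QuotMod L) =
      x.coeff.sum fun i a => a • e i := by
    intro x
    conv_lhs => rw [eq_sum x]
    unfold Finsupp.sum
    rw [← Submodule.mkQ_apply, map_sum]
    rfl
  have hn : e n ∈ W := by
    have h0 : (Submodule.Quotient.mk L : QuotMod L) = 0 :=
      (Submodule.Quotient.mk_eq_zero _).mpr (Submodule.mem_span_singleton_self L)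
    rw [hsum L] at h0
    unfold Finsupp.sum at h0
    have hmem : n ∈ S := S.max'_mem hS
    rw [← Finset.add_sum_erase _ _ hmem] at h0
    have hne : L.coeff n ≠ 0 := Finsupp.mem_support_iff.mp hmem
    refine (W.smul_mem_iff hne).mp ?_
    have := eq_neg_of_add_eq_zero_left h0
    beta_reduce at this
    rw [this]
    refine W.neg_mem (W.sum_mem fun i hi => W.smul_mem _ (hlt i ?_))
    exact lt_of_le_of_ne (S.le_max' i (Finset.mem_of_mem_erase hi)) (Finset.ne_of_mem_erase hi)
  have hstab : ∀ w ∈ W, (D : DiffOp F) • w ∈ W := by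
    intro w hw
    induction hw using Submodule.span_induction with
    | mem x hx =>
      obtain ⟨i, hi, rfl⟩ := hx
      have : (D : DiffOp F) • e i = e (i + 1) := by
        change Submodule.Quotient.mk (D * D ^ i) = Submodule.Quotient.mk (D ^ (i + 1))
        rw [pow_succ']
      rw [this]
      rcases Nat.lt_or_ge (i + 1) n with h | h
      · exact hlt _ h
      · have : i + 1 = n := le_antisymm hi h
        rw [this]
        exact hn
    | zero => rw [smul_zero]; exact W.zero_mem
    | add x y _ _ hx hy => rw [smul_add]; exact W.add_mem hx hy
    | smul a x hx' hx =>
      rw [← C_smul_quot, smul_smul, D_mul_C, add_smul, C_smul_quot, ← smul_smul, C_smul_quot]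
      exact W.add_mem (W.smul_mem _ hx) (W.smul_mem _ hx')
  have hall : ∀ i, e i ∈ W := by
    intro i
    induction i with
    | zero =>
      rcases Nat.eq_zero_or_pos n with h | h
      · rw [h] at hn
        exact hn
      · exact hlt 0 h
    | succ i ih =>
      have : e (i + 1) = (D : DiffOp F) • e i := by
        change Submodule.Quotient.mk (D ^ (i + 1)) = Submodule.Quotient.mk (D * D ^ i)
        rw [pow_succ']
      rw [this]
      exact hstab _ ih
  have htop : W = ⊤ := by
    refine Submodule.eq_top_iff'.mpr fun x => ?_
    obtain ⟨y, rfl⟩ := Submodule.Quotient.mk_surjective _ x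
    rw [hsum y]
    exact W.sum_mem fun i _ => W.smul_mem _ (hall i)
  refine ⟨?_⟩
  rw [← htop]
  exact Submodule.fg_span ((Set.finite_Iio n).image e)

/-- The characteristic polynomial `χ(ψ_p^L)` of the `p`-curvature of a nonzero operator `L`. -/
def pCurvatureCharpoly (p : ℕ) [Fact p.Prime] [CharP F p] (L : DiffOp F) (hL : L ≠ 0) :
    Polynomial (RatFunc F) :=
  haveI := finite_quotMod L hL
  (pCurvature p L).charpoly

/-- The subfield `F(tᵖ)` of `F(t)`. -/
def frobSubfield (F : Type*) [Field F] (p : ℕ) : IntermediateField F (RatFunc F) :=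
  IntermediateField.adjoin F {(RatFunc.X : RatFunc F) ^ p}

/-- The polynomial `χ(ψ_p^L)` has no inseparable irreducible factor over `F(tᵖ)`. As `χ(ψ_p^L)`
has its coefficients in `F(tᵖ)`, a polynomial over `F(tᵖ)` divides it over `F(tᵖ)` if and only if
it divides it over `F(t)`. -/
def SeparabilityHypothesis (p : ℕ) [Fact p.Prime] [CharP F p] (L : DiffOp F) (hL : L ≠ 0) :
    Prop :=
  ∀ N : Polynomial (frobSubfield F p), Irreducible N →
    N.map (algebraMap (frobSubfield F p) (RatFunc F)) ∣ pCurvatureCharpoly p L hL → N.Separable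

end DiffOp

end

/-! ### Indecomposable modules over a self-injective ring that is simple modulo a nilpotent
central element -/

/-! Write `R` for the ring of operators and `C` for the field of constants. Equivalence implies
equality of characteristic polynomials because a module isomorphism conjugates the two
`p`-curvatures.

For the converse, the center of `R` is `C[∂ᵖ]`, and `𝒟_L` is killed by a nonzero central element: by
Frobenius `χᵖ` has constant coefficients, and Cayley–Hamilton applies. If `𝒟_L` is nonzero and
indecomposable, Bézout splittings leave a single irreducible `N` and an exact exponent `k` with `N ^
k` acting as zero (`exists_hasExponent`).

The pair `(N, k)` determines the module. Let `A = R/(N ^ k)`, with `ν` the class of `N`, and `B =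
A/(ν) = R/(N)`. Then `B` is simple Artinian and `A` is self-injective, both because one-sided ideals
of `R` are principal (`isSimpleRing_quotient`, `baer_quotient`). Lift a primitive idempotent of `B`
to `e` in `A`. Every nonzero left ideal inside `A e` contains `ν ^ (k - 1) e`, so a map from `A e`
to an indecomposable module `M` that does not kill this element is injective. It splits because `A
e` is injective, so it is an isomorphism (`IsIndecomposableModule.exists_generator`).

The polynomial `χ` determines `(N, k)`. It divides a power of `N`, which fixes `N` up to a unit, and
its degree is the dimension. If the exponents were `j < k`, the quotient `M'/N ^ j M'` would be
indecomposable of exponent `j`, hence isomorphic to `M`. As `M` and `M'` have equal dimension this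
forces `N ^ j M' = 0`, a contradiction (`HasExponent.not_lt_of_finrank_eq`). -/

/-- A module is indecomposable if it has no nontrivial direct sum decomposition. -/
def IsIndecomposableModule (A M : Type*) [Ring A] [AddCommGroup M] [Module A M] : Prop :=
  ∀ U V : Submodule A M, IsCompl U V → U = ⊥ ∨ V = ⊥

/-- A minimal left ideal of a semisimple ring is generated by an idempotent `e`; by minimality any
nonzero `x * e` generates the same ideal. -/
theorem exists_primitive_idempotent (B : Type*) [Ring B] [IsSimpleRing B] [IsArtinianRing B] :
    ∃ e : B, IsIdempotentElem e ∧ e ≠ 0 ∧ ∀ x, x * e ≠ 0 → ∃ y, y * (x * e) = e := by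
  obtain ⟨I, hI⟩ := IsAtomic.exists_atom (Ideal B)
  obtain ⟨e, he, rfl⟩ := IsSemisimpleRing.ideal_eq_span_idempotent I
  refine ⟨e, he, fun h => hI.1 (by simp [h]), fun x hx => ?_⟩
  have h1 : Ideal.span {x * e} ≤ Ideal.span {e} := by
    rw [Ideal.span_singleton_le_iff_mem]
    exact Ideal.mul_mem_left _ _ (Ideal.mem_span_singleton_self e)
  have h2 : Ideal.span {x * e} = Ideal.span {e} :=
    (hI.le_iff.mp h1).resolve_left fun h => hx (Ideal.span_singleton_eq_bot.mp h)
  exact Ideal.mem_span_singleton'.mp (h2 ▸ Ideal.mem_span_singleton_self e)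

section Lift

variable {A B : Type*} [Ring A] [Ring B] {ν : A} {k : ℕ} {π : A →+* B}

theorem exists_lift_primitive_idempotent [IsSimpleRing B] [IsArtinianRing B]
    (hν : ∀ a, Commute ν a) (hk : ν ^ k = 0) (hπ : Function.Surjective π)
    (hker : ∀ a, π a = 0 ↔ ∃ b, a = ν * b) :
    ∃ e : A, IsIdempotentElem e ∧ π e ≠ 0 ∧ ∀ a, π (a * e) ≠ 0 → ∃ b, b * (a * e) = e := by
  obtain ⟨e₀, he₀, hne, hmin⟩ := exists_primitive_idempotent B
  have hnil : ∀ c, IsNilpotent (ν * c) := fun c => ⟨k, by rw [(hν c).mul_pow, hk, zero_mul]⟩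
  obtain ⟨e, he, rfl⟩ := exists_isIdempotentElem_eq_of_ker_isNilpotent π
    (fun x hx => by
      obtain ⟨b, rfl⟩ := (hker x).mp hx
      exact hnil b) e₀ (hπ e₀) he₀
  refine ⟨e, he, hne, fun a ha => ?_⟩
  obtain ⟨y, hy⟩ := hmin (π a) (by rwa [← map_mul])
  obtain ⟨y, rfl⟩ := hπ y
  obtain ⟨c, hc⟩ := (hker (e - y * (a * e))).mp (by
    rw [map_sub, map_mul, map_mul, hy, sub_self])
  -- Primitivity in `B` gives `y a e = e - ν c`. Multiplying by `e` on the right turns this into `(1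
  -- - ν c) e`, and `1 - ν c` is invertible.
  obtain ⟨u, hu⟩ := (hnil c).isUnit_one_sub
  refine ⟨↑u⁻¹ * y, ?_⟩
  have h1 : (u : A) * e = y * (a * e) := by
    have h2 : ν * (c * e) = e - y * (a * e) := by
      rw [← mul_assoc, ← hc, sub_mul, mul_assoc y, mul_assoc a, he.eq]
    rw [hu, sub_mul, one_mul, mul_assoc, h2, sub_sub_cancel]
  rw [mul_assoc, ← h1, Units.inv_mul_cancel_left]

/-- `A e` has a simple socle, generated by `ν ^ (k - 1) e`. Write `a e = ν ^ j c e` with `j` as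
large as possible; then `c e` is nonzero modulo `ν`, so some `b` takes it to `e`, and `ν ^ (k - 1 -
j) b` does the rest. -/
theorem exists_mul_eq_pow_mul_of_ne_zero {e : A} (hν : ∀ a, Commute ν a) (hk : ν ^ k = 0)
    (hker : ∀ a, π a = 0 ↔ ∃ b, a = ν * b) (he : IsIdempotentElem e)
    (hmin : ∀ a, π (a * e) ≠ 0 → ∃ b, b * (a * e) = e) {a : A} (ha : a * e ≠ 0) :
    ∃ b, b * (a * e) = ν ^ (k - 1) * e := by
  by_contra! hcon
  have key : ∀ j, ∃ c, a * e = ν ^ j * (c * e) := by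
    intro j
    induction j with
    | zero => exact ⟨a, by rw [pow_zero, one_mul]⟩
    | succ j ih =>
      obtain ⟨c, hc⟩ := ih
      have hj : j < k := by
        by_contra hj
        apply ha
        rw [hc, pow_eq_zero_of_le (not_lt.mp hj) hk, zero_mul]
      have h0 : π (c * e) = 0 := by
        by_contra h0
        obtain ⟨b, hb⟩ := hmin c h0
        apply hcon (ν ^ (k - 1 - j) * b)
        rw [hc, mul_assoc, ← mul_assoc b, ← ((hν b).pow_left j).eq, mul_assoc (ν ^ j), hb,
          ← mul_assoc, ← pow_add]
        congr 2
        omega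
      obtain ⟨d, hd⟩ := (hker _).mp h0
      refine ⟨d, ?_⟩
      rw [hc, ← he.eq, ← mul_assoc c, hd, he.eq, pow_succ, mul_assoc (ν ^ j), mul_assoc ν]
  obtain ⟨c, hc⟩ := key k
  rw [hk, zero_mul] at hc
  exact ha hc

/-! ### Indecomposable modules over the lifted ring -/

variable {M : Type*} [AddCommGroup M] [Module A M]

/-- Since `ν ^ k = 0`, the action of `ν ^ (k - 1) a` depends only on `π a`. The classes acting as
zero form a two-sided ideal of `B`, proper because `1` is not in it; by simplicity it is zero and
misses `π e`. -/
theorem exists_pow_smul_smul_ne_zero [IsSimpleRing B] {e : A} (hν : ∀ a, Commute ν a)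
    (hk : ν ^ k = 0) (hπ : Function.Surjective π) (hker : ∀ a, π a = 0 ↔ ∃ b, a = ν * b)
    (hne : π e ≠ 0) (hM : ∃ m : M, ν ^ (k - 1) • m ≠ 0) :
    ∃ m : M, (ν ^ (k - 1) * e) • m ≠ 0 := by
  by_contra! hcon
  have hk0 : k ≠ 0 := by
    rintro rfl
    obtain ⟨m, hm⟩ := hM
    apply hm
    rw [zero_tsub, hk, zero_smul]
  have hπν : ∀ a b, π a = π b → ∀ m : M, (ν ^ (k - 1) * a) • m = (ν ^ (k - 1) * b) • m := by
    intro a b hab m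
    obtain ⟨c, hc⟩ := (hker (a - b)).mp (by rw [map_sub, hab, sub_self])
    rw [← sub_eq_zero, ← sub_smul, ← mul_sub, hc, ← mul_assoc, ← pow_succ,
      Nat.sub_one_add_one hk0, hk, zero_mul, zero_smul]
  let T : TwoSidedIdeal B := TwoSidedIdeal.mk'
    {x | ∀ a, π a = x → ∀ m : M, (ν ^ (k - 1) * a) • m = 0}
    (fun a ha m => by rw [hπν a 0 (by rw [ha, map_zero]), mul_zero, zero_smul])
    (by
      intro x y hx hy a ha m
      obtain ⟨b, rfl⟩ := hπ x
      obtain ⟨c, rfl⟩ := hπ y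
      rw [hπν a (b + c) (by rw [ha, map_add]), mul_add, add_smul, hx b rfl, hy c rfl, add_zero])
    (by
      intro x hx a ha m
      have := hx (-a) (by rw [map_neg, ha, neg_neg]) m
      rwa [mul_neg, neg_smul, neg_eq_zero] at this)
    (by
      intro x y hy a ha m
      obtain ⟨b, rfl⟩ := hπ x
      obtain ⟨c, rfl⟩ := hπ y
      rw [hπν a (b * c) (by rw [ha, map_mul]), ← mul_assoc, ((hν b).pow_left _).eq, mul_assoc,
        mul_smul, hy c rfl, smul_zero])
    (by
      intro x y hx a ha m
      obtain ⟨b, rfl⟩ := hπ x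
      obtain ⟨c, rfl⟩ := hπ y
      rw [hπν a (b * c) (by rw [ha, map_mul]), ← mul_assoc, mul_smul, hx b rfl])
  have hT : ∀ x, x ∈ T ↔ ∀ a, π a = x → ∀ m : M, (ν ^ (k - 1) * a) • m = 0 := fun x =>
    TwoSidedIdeal.mem_mk' ..
  have heT : π e ∈ T := (hT _).mpr fun a ha m => by rw [hπν a e ha, hcon]
  have hT1 : T = ⊤ := (eq_bot_or_eq_top T).resolve_left fun h => hne (by
    rw [h] at heT
    exact (TwoSidedIdeal.mem_bot _).mp heT)
  obtain ⟨m, hm⟩ := hM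
  apply hm
  have := (hT 1).mp (by rw [hT1]; trivial) 1 (map_one π) m
  rwa [mul_one] at this

/-- `A e` is a direct summand of `A`: extend the map into `A`, then multiply by `e` on the right. -/
theorem baer_span_idempotent (hA : Module.Baer A A) {e : A} (he : IsIdempotentElem e) :
    Module.Baer A (Ideal.span {e}) := by
  intro I g
  obtain ⟨h, hh⟩ := hA I ((Ideal.span {e}).subtype ∘ₗ g)
  refine ⟨(LinearMap.toSpanSingleton A (Ideal.span {e})
    ⟨e, Ideal.mem_span_singleton_self e⟩) ∘ₗ h, fun x hx => ?_⟩
  apply Subtype.ext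
  obtain ⟨a, ha⟩ := Ideal.mem_span_singleton'.mp (g ⟨x, hx⟩).2
  have := hh x hx
  simp only [LinearMap.comp_apply, Submodule.subtype_apply] at this
  simp only [LinearMap.comp_apply, LinearMap.toSpanSingleton_apply, this, Submodule.coe_smul,
    smul_eq_mul]
  rw [← ha, mul_assoc, he.eq]

/-- An indecomposable module on which `ν ^ (k - 1)` does not vanish is isomorphic to `A e`. -/
theorem IsIndecomposableModule.exists_generator [IsSimpleRing B] {e : A}
    (hM : IsIndecomposableModule A M) (hA : Module.Baer A A) (hν : ∀ a, Commute ν a)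
    (hk : ν ^ k = 0) (hπ : Function.Surjective π) (hker : ∀ a, π a = 0 ↔ ∃ b, a = ν * b)
    (he : IsIdempotentElem e) (hne : π e ≠ 0)
    (hmin : ∀ a, π (a * e) ≠ 0 → ∃ b, b * (a * e) = e) (hMk : ∃ m : M, ν ^ (k - 1) • m ≠ 0) :
    ∃ m : M, (∀ x, ∃ a : A, a • m = x) ∧ ∀ a : A, a • m = 0 ↔ a * e = 0 := by
  obtain ⟨m, hm⟩ := exists_pow_smul_smul_ne_zero hν hk hπ hker hne hMk
  let φ : Ideal.span {e} →ₗ[A] M := LinearMap.toSpanSingleton A M m ∘ₗ (Ideal.span {e}).subtype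
  have hφ : ∀ x, φ x = (x : A) • m := fun x => rfl
  have hinj : Function.Injective φ := by
    rw [injective_iff_map_eq_zero]
    rintro ⟨x, hx⟩ h0
    obtain ⟨a, rfl⟩ := Ideal.mem_span_singleton'.mp hx
    by_contra hne0
    obtain ⟨b, hb⟩ := exists_mul_eq_pow_mul_of_ne_zero hν hk hker he hmin
      (a := a) fun h => hne0 (Subtype.ext h)
    apply hm
    rw [hφ] at h0
    rw [← hb, mul_smul, h0, smul_zero]
  -- Injectivity of `A e` provides a retraction `r` of `φ`, so `M` is the direct sum of the image of
  -- `φ` and the kernel of `r`.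
  obtain ⟨r, hr⟩ := (baer_span_idempotent hA he).extension_property φ hinj LinearMap.id
  have hrφ : ∀ x, r (φ x) = x := fun x => DFunLike.congr_fun hr x
  have hcompl : IsCompl (LinearMap.range φ) (LinearMap.ker r) := by
    refine ⟨Submodule.disjoint_def.mpr ?_, codisjoint_iff.mpr (Submodule.eq_top_iff'.mpr fun x =>
      Submodule.mem_sup.mpr ⟨φ (r x), LinearMap.mem_range_self _ _, x - φ (r x), ?_, by abel⟩)⟩
    · rintro _ ⟨x, rfl⟩ hx
      rw [LinearMap.mem_ker, hrφ] at hx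
      rw [hx, map_zero]
    · rw [LinearMap.mem_ker, map_sub, hrφ, sub_self]
  have hker0 : LinearMap.ker r = ⊥ := by
    refine (hM _ _ hcompl).resolve_left fun h => hne ?_
    have h1 : φ ⟨e, Ideal.mem_span_singleton_self e⟩ = 0 := by
      rw [← Submodule.mem_bot A, ← h]
      exact LinearMap.mem_range_self _ _
    have h2 := congrArg Subtype.val (hinj (h1.trans (map_zero φ).symm))
    rw [show e = 0 from h2, map_zero]
  have htop : LinearMap.range φ = ⊤ := by
    have := hcompl.sup_eq_top
    rwa [hker0, sup_bot_eq] at this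
  refine ⟨e • m, fun x => ?_, fun a => ?_⟩
  · obtain ⟨⟨y, hy⟩, rfl⟩ := LinearMap.range_eq_top.mp htop x
    obtain ⟨a, rfl⟩ := Ideal.mem_span_singleton'.mp hy
    exact ⟨a, by rw [hφ, mul_smul]⟩
  · rw [← mul_smul]
    have := map_eq_zero_iff φ hinj
      (x := ⟨a * e, Ideal.mul_mem_left _ a (Ideal.mem_span_singleton_self e)⟩)
    rw [hφ, Submodule.mk_eq_zero] at this
    exact this

theorem nonempty_linearEquiv_of_generators {M' : Type*} [AddCommGroup M'] [Module A M'] {m : M}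
    {m' : M'} (hm : ∀ x, ∃ a : A, a • m = x) (hm' : ∀ x, ∃ a : A, a • m' = x)
    (h : ∀ a : A, a • m = 0 ↔ a • m' = 0) : Nonempty (M ≃ₗ[A] M') := by
  have hk : LinearMap.ker (LinearMap.toSpanSingleton A M m) =
      LinearMap.ker (LinearMap.toSpanSingleton A M' m') := by
    ext a
    exact h a
  exact ⟨((LinearMap.toSpanSingleton A M m).quotKerEquivOfSurjective hm).symm ≪≫ₗ
    Submodule.quotEquivOfEq _ _ hk ≪≫ₗ
    (LinearMap.toSpanSingleton A M' m').quotKerEquivOfSurjective hm'⟩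

/-- Two indecomposable modules on which `ν ^ (k - 1)` does not vanish are isomorphic. -/
theorem IsIndecomposableModule.nonempty_linearEquiv [IsSimpleRing B] [IsArtinianRing B]
    {M' : Type*} [AddCommGroup M'] [Module A M'] (hM : IsIndecomposableModule A M)
    (hM' : IsIndecomposableModule A M') (hA : Module.Baer A A) (hν : ∀ a, Commute ν a)
    (hk : ν ^ k = 0) (hπ : Function.Surjective π) (hker : ∀ a, π a = 0 ↔ ∃ b, a = ν * b)
    (hMk : ∃ m : M, ν ^ (k - 1) • m ≠ 0) (hMk' : ∃ m : M', ν ^ (k - 1) • m ≠ 0) :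
    Nonempty (M ≃ₗ[A] M') := by
  obtain ⟨e, he, hne, hmin⟩ := exists_lift_primitive_idempotent hν hk hπ hker
  obtain ⟨m, hm, hm0⟩ := hM.exists_generator hA hν hk hπ hker he hne hmin hMk
  obtain ⟨m', hm', hm0'⟩ := hM'.exists_generator hA hν hk hπ hker he hne hmin hMk'
  exact nonempty_linearEquiv_of_generators hm hm' fun a => (hm0 a).trans (hm0' a).symm

/-- The only submodule of an indecomposable module not contained in its multiples of `ν` is the
whole module. -/
theorem IsIndecomposableModule.eq_top_of_notMem [IsSimpleRing B] [IsArtinianRing B]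
    (hM : IsIndecomposableModule A M) (hA : Module.Baer A A) (hν : ∀ a, Commute ν a)
    (hk : ν ^ k = 0) (hπ : Function.Surjective π) (hker : ∀ a, π a = 0 ↔ ∃ b, a = ν * b)
    (hMk : ∃ m : M, ν ^ (k - 1) • m ≠ 0) {Q : Submodule A M} {q : M} (hq : q ∈ Q)
    (hqν : ∀ x, ν • x ≠ q) : Q = ⊤ := by
  obtain ⟨e, he, hne, hmin⟩ := exists_lift_primitive_idempotent hν hk hπ hker
  obtain ⟨m, hm, hm0⟩ := hM.exists_generator hA hν hk hπ hker he hne hmin hMk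
  -- The annihilator of `m` is that of `e` under left multiplication, and `(e - 1) e = 0`.
  have hem : e • m = m := by
    have := (hm0 (e - 1)).mpr (by rw [sub_mul, he.eq, one_mul, sub_self])
    rwa [sub_smul, one_smul, sub_eq_zero] at this
  obtain ⟨a, rfl⟩ := hm q
  -- Otherwise `a e` is a multiple of `ν`, and so is `q = a e m`.
  have h1 : π (a * e) ≠ 0 := by
    intro h
    obtain ⟨b, hb⟩ := (hker _).mp h
    apply hqν (b • m)
    rw [smul_smul, ← hb, mul_smul, hem]
  obtain ⟨b, hb⟩ := hmin a h1
  have hmQ : m ∈ Q := by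
    rw [← hem, ← hb, mul_smul, mul_smul, hem]
    exact Q.smul_mem b hq
  refine Submodule.eq_top_iff'.mpr fun x => ?_
  obtain ⟨c, rfl⟩ := hm x
  exact Q.smul_mem c hmQ

/-- Indecomposability over a ring and over a quotient ring agree. -/
theorem IsIndecomposableModule.quotient {I : Ideal A} [I.IsTwoSided] [Module (A ⧸ I) M]
    [IsScalarTower A (A ⧸ I) M]
    (hM : IsIndecomposableModule A M) : IsIndecomposableModule (A ⧸ I) M := by
  intro U V hUV
  have h := hM (U.restrictScalars A) (V.restrictScalars A) ⟨?_, ?_⟩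
  · simpa only [Submodule.restrictScalars_eq_bot_iff] using h
  · rw [Submodule.disjoint_def]
    exact fun x hx hx' => Submodule.disjoint_def.mp hUV.1 x hx hx'
  · rw [codisjoint_iff, Submodule.eq_top_iff']
    intro x
    have hx : x ∈ U ⊔ V := by
      rw [hUV.sup_eq_top]
      trivial
    obtain ⟨u, hu, v, hv, rfl⟩ := Submodule.mem_sup.mp hx
    exact Submodule.mem_sup.mpr ⟨u, hu, v, hv, rfl⟩

end Lift

noncomputable section

namespace DiffOp

variable {F : Type*} [Field F]

/-! ### Division with remainder -/

theorem coeff_add (x y : DiffOp F) (i : ℕ) : (x + y).coeff i = x.coeff i + y.coeff i := rfl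

theorem coeff_zero (i : ℕ) : (0 : DiffOp F).coeff i = 0 := rfl

theorem coeff_neg (x : DiffOp F) (i : ℕ) : (-x).coeff i = -x.coeff i := rfl

theorem coeff_sub (x y : DiffOp F) (i : ℕ) : (x - y).coeff i = x.coeff i - y.coeff i := by
  rw [sub_eq_add_neg, coeff_add, coeff_neg, sub_eq_add_neg]

theorem coeff_smul (a : RatFunc F) (x : DiffOp F) (i : ℕ) : (a • x).coeff i = a * x.coeff i := rfl

theorem coeff_mono_apply (i j : ℕ) (a : RatFunc F) :
    (mono i a).coeff j = if i = j then a else 0 := by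
  rw [coeff_mono, Finsupp.single_apply]

theorem ext_coeff {x y : DiffOp F} (h : ∀ i, x.coeff i = y.coeff i) : x = y :=
  DiffOp.ext (Finsupp.ext h)

/-- The operators of order less than `n`. -/
def orderLT (F : Type*) [Field F] (n : ℕ) : Submodule (RatFunc F) (DiffOp F) where
  carrier := {x | ∀ i, n ≤ i → x.coeff i = 0}
  add_mem' hx hy i hi := by rw [coeff_add, hx i hi, hy i hi, add_zero]
  zero_mem' i _ := coeff_zero i
  smul_mem' a x hx i hi := by rw [coeff_smul, hx i hi, mul_zero]

theorem orderLT_mono {m n : ℕ} (h : m ≤ n) : orderLT F m ≤ orderLT F n :=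
  fun _ hx i hi => hx i (h.trans hi)

theorem mono_mem_orderLT {i n : ℕ} (h : i < n) (a : RatFunc F) : mono i a ∈ orderLT F n := by
  intro j hj
  rw [coeff_mono_apply, if_neg (by omega)]

theorem mem_orderLT_of_coeff_eq_zero {n : ℕ} {x : DiffOp F} (hx : x ∈ orderLT F (n + 1))
    (h : x.coeff n = 0) : x ∈ orderLT F n := by
  intro i hi
  rcases hi.eq_or_lt with rfl | hi
  · exact h
  · exact hx i hi

theorem exists_mem_orderLT (x : DiffOp F) : ∃ n, x ∈ orderLT F n := by
  refine ⟨x.coeff.support.sup id + 1, fun i hi => ?_⟩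
  by_contra h
  have := Finset.le_sup (f := id) (Finsupp.mem_support_iff.mpr h)
  simp only [id] at this
  omega

theorem exists_order {x : DiffOp F} (hx : x ≠ 0) :
    ∃ n, x ∈ orderLT F (n + 1) ∧ x.coeff n ≠ 0 := by
  classical
  have h := exists_mem_orderLT x
  have h0 : Nat.find h ≠ 0 := by
    intro h0
    apply hx
    have := Nat.find_spec h
    rw [h0] at this
    exact ext_coeff fun i => this i (Nat.zero_le i)
  obtain ⟨n, hn⟩ := Nat.exists_eq_succ_of_ne_zero h0
  have h1 := Nat.find_spec h
  rw [hn] at h1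
  refine ⟨n, h1, fun h2 => ?_⟩
  exact Nat.find_min h (m := n) (by omega) (mem_orderLT_of_coeff_eq_zero h1 h2)

theorem coeff_dLeft (x : DiffOp F) (i : ℕ) :
    (dLeft x).coeff i = ratDeriv F (x.coeff i) + if i = 0 then 0 else x.coeff (i - 1) := by
  let c : ℕ → DiffOp F →+ RatFunc F := fun i =>
    (Finsupp.applyAddHom i).comp (coeffLinear F).toLinearMap.toAddMonoidHom
  have hc : ∀ i x, c i x = x.coeff i := fun _ _ => rfl
  have : (c i).comp dLeft = ((ratDeriv F : RatFunc F →+ RatFunc F).comp (c i)) +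
      if i = 0 then 0 else c (i - 1) := by
    refine addHom_ext fun j a => ?_
    have h0 : ((c i).comp dLeft) (mono j a) = (dLeft (mono j a)).coeff i := rfl
    have h0' : ((ratDeriv F : RatFunc F →+ RatFunc F).comp (c i)) (mono j a) =
      ratDeriv F ((mono j a).coeff i) := rfl
    rw [AddMonoidHom.add_apply, h0, h0', dLeft_mono, coeff_add, coeff_mono_apply,
      coeff_mono_apply, coeff_mono_apply]
    have h1 : (if i = 0 then (0 : DiffOp F →+ RatFunc F) else c (i - 1)) (mono j a) =
        if j + 1 = i then a else 0 := by
      split_ifs with h2 h3 h3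
      · omega
      · rfl
      · rw [hc, coeff_mono_apply, if_pos (by omega)]
      · rw [hc, coeff_mono_apply, if_neg (by omega)]
    rw [h1]
    split_ifs <;> simp
  have h2 := DFunLike.congr_fun this x
  have h3 : (dLeft x).coeff i = ((c i).comp dLeft) x := rfl
  rw [h3, h2, AddMonoidHom.add_apply]
  split_ifs <;> rfl

/-- Each `∂` shifts the leading coefficient up by one degree; its derivative only enters in lower
order. -/
theorem dLeftPow_mem_orderLT (m : ℕ) {n : ℕ} {x : DiffOp F} (hx : x ∈ orderLT F (n + 1)) :
    dLeftPow m x ∈ orderLT F (m + n + 1) ∧ (dLeftPow m x).coeff (m + n) = x.coeff n := by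
  induction m with
  | zero =>
    rw [zero_add]
    exact ⟨hx, rfl⟩
  | succ m ih =>
    have h1 : dLeftPow (m + 1) x = dLeft (dLeftPow m x) := rfl
    rw [h1]
    constructor
    · intro i hi
      rw [coeff_dLeft, ih.1 i (by omega), map_zero, zero_add, if_neg (by omega),
        ih.1 _ (by omega)]
    · rw [coeff_dLeft, ih.1 _ (by omega), map_zero, zero_add, if_neg (by omega), ← ih.2]
      congr 1
      omega

theorem mul_mem_orderLT {m n : ℕ} {x y : DiffOp F} (hx : x ∈ orderLT F (m + 1))
    (hy : y ∈ orderLT F (n + 1)) :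
    x * y ∈ orderLT F (m + n + 1) ∧ (x * y).coeff (m + n) = x.coeff m * y.coeff n := by
  classical
  have hsum : x = ∑ i ∈ Finset.range (m + 1), mono i (x.coeff i) := by
    conv_lhs => rw [sum_mono x]
    refine Finsupp.sum_of_support_subset _ (fun i hi => ?_) _ fun i _ => map_zero _
    by_contra h
    exact Finsupp.mem_support_iff.mp hi (hx i (by simpa using h))
  have hlow : ∀ i < m, x.coeff i • dLeftPow i y ∈ orderLT F (m + n) := fun i hi =>
    orderLT_mono (by omega) (Submodule.smul_mem _ _ (dLeftPow_mem_orderLT i hy).1)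
  have h1 : x * y = (∑ i ∈ Finset.range m, x.coeff i • dLeftPow i y) +
      x.coeff m • dLeftPow m y := by
    conv_lhs => rw [hsum, Finset.sum_mul, Finset.sum_range_succ]
    simp only [mono_mul]
  have h2 : (∑ i ∈ Finset.range m, x.coeff i • dLeftPow i y) ∈ orderLT F (m + n) :=
    Submodule.sum_mem _ fun i hi => hlow i (Finset.mem_range.mp hi)
  have h3 := dLeftPow_mem_orderLT m hy
  rw [h1]
  refine ⟨Submodule.add_mem _ (orderLT_mono (Nat.le_succ _) h2) (Submodule.smul_mem _ _ h3.1), ?_⟩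
  rw [coeff_add, h2 _ le_rfl, zero_add, coeff_smul, h3.2]

instance : Nontrivial (DiffOp F) := C_injective.nontrivial

instance : NoZeroDivisors (DiffOp F) where
  eq_zero_or_eq_zero_of_mul_eq_zero {x y} h := by
    by_contra! hne
    obtain ⟨m, hm, hm'⟩ := exists_order hne.1
    obtain ⟨n, hn, hn'⟩ := exists_order hne.2
    have := (mul_mem_orderLT hm hn).2
    rw [h, coeff_zero] at this
    exact mul_ne_zero hm' hn' this.symm

instance : IsDomain (DiffOp F) := NoZeroDivisors.to_isDomain _

theorem exists_sub_mul_mem_orderLT {n : ℕ} {y : DiffOp F} (hy : y ∈ orderLT F (n + 1))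
    (hy' : y.coeff n ≠ 0) (x : DiffOp F) : ∃ q, x - q * y ∈ orderLT F n := by
  have key : ∀ (k : ℕ) (x : DiffOp F), x ∈ orderLT F (n + k) → ∃ q, x - q * y ∈ orderLT F n := by
    intro k
    induction k with
    | zero =>
      intro x hx
      exact ⟨0, by simpa using hx⟩
    | succ k ih =>
      intro x hx
      -- Chosen so that `a ∂ᵏ y` cancels the term of `x` of order `n + k`.
      set a := x.coeff (n + k) / y.coeff n
      have h1 := mul_mem_orderLT (mono_mem_orderLT (Nat.lt_succ_self k) a) hy
      have h2 : x - mono k a * y ∈ orderLT F (n + k) := by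
        refine mem_orderLT_of_coeff_eq_zero (Submodule.sub_mem _ hx ?_) ?_
        · exact orderLT_mono (by omega) h1.1
        · rw [coeff_sub, add_comm n k, h1.2, coeff_mono_apply, if_pos rfl,
            div_mul_cancel₀ _ hy', add_comm k n, sub_self]
      obtain ⟨q, hq⟩ := ih _ h2
      exact ⟨mono k a + q, by rwa [add_mul, ← sub_sub]⟩
  obtain ⟨m, hm⟩ := exists_mem_orderLT x
  exact key m x (orderLT_mono (Nat.le_add_left m n) hm)

theorem mem_leftIdeal {L x : DiffOp F} : x ∈ leftIdeal L ↔ ∃ q, q * L = x :=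
  Submodule.mem_span_singleton

/-- A nonzero left ideal is generated by a monic operator `g` such that no other nonzero element
has smaller order. -/
theorem exists_monic_generator {I : Submodule (DiffOp F) (DiffOp F)} (hI : I ≠ ⊥) :
    ∃ (g : DiffOp F) (n : ℕ), I = leftIdeal g ∧ g ∈ orderLT F (n + 1) ∧ g.coeff n = 1 ∧
      ∀ x ∈ I, x ∈ orderLT F n → x = 0 := by
  classical
  have hex : ∃ n, ∃ x ∈ I, x ∈ orderLT F (n + 1) ∧ x.coeff n ≠ 0 := by
    obtain ⟨x, hx, hx0⟩ := Submodule.exists_mem_ne_zero_of_ne_bot hI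
    obtain ⟨n, hn⟩ := exists_order hx0
    exact ⟨n, x, hx, hn⟩
  obtain ⟨x, hxI, hx, hx'⟩ := Nat.find_spec hex
  set n := Nat.find hex
  have hmin : ∀ y ∈ I, y ∈ orderLT F n → y = 0 := by
    intro y hy hyn
    by_contra hy0
    obtain ⟨m, hm, hm'⟩ := exists_order hy0
    refine Nat.find_min hex (m := m) ?_ ⟨y, hy, hm, hm'⟩
    by_contra hmn
    exact hm' (hyn m (not_lt.mp hmn))
  have hgI : C (x.coeff n)⁻¹ * x ∈ I := I.smul_mem _ hxI
  rw [← smul_eq] at hgI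
  have hg : (x.coeff n)⁻¹ • x ∈ orderLT F (n + 1) := Submodule.smul_mem _ _ hx
  have hg' : ((x.coeff n)⁻¹ • x).coeff n = 1 := by rw [coeff_smul, inv_mul_cancel₀ hx']
  refine ⟨(x.coeff n)⁻¹ • x, n, le_antisymm (fun y hy => ?_) ?_, hg, hg', hmin⟩
  · obtain ⟨q, hq⟩ := exists_sub_mul_mem_orderLT hg (by rw [hg']; exact one_ne_zero) y
    have := hmin _ (I.sub_mem hy (I.smul_mem q hgI)) hq
    exact mem_leftIdeal.mpr ⟨q, (sub_eq_zero.mp this).symm⟩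
  · exact (Submodule.span_singleton_le_iff_mem _ _).mpr hgI

theorem exists_eq_leftIdeal (I : Submodule (DiffOp F) (DiffOp F)) : ∃ g, I = leftIdeal g := by
  by_cases hI : I = ⊥
  · exact ⟨0, by rw [hI, leftIdeal, Submodule.span_zero_singleton]⟩
  · obtain ⟨g, _, h, _⟩ := exists_monic_generator hI
    exact ⟨g, h⟩

theorem leftIdeal_C_eq (a : RatFunc F) : leftIdeal (C a) = ⊥ ∨ leftIdeal (C a) = ⊤ := by
  by_cases ha : a = 0
  · left
    rw [ha, map_zero, leftIdeal, Submodule.span_zero_singleton]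
  · right
    refine Submodule.eq_top_iff'.mpr fun x => mem_leftIdeal.mpr ⟨x * C a⁻¹, ?_⟩
    rw [mul_assoc, ← map_mul, inv_mul_cancel₀ ha, map_one, mul_one]

/-! ### From decompositions of the module to decompositions of the operator -/

/-- The module of an indecomposable operator is indecomposable. -/
theorem Indecomposable.isIndecomposableModule {L : DiffOp F} (hL : Indecomposable L) :
    IsIndecomposableModule (DiffOp F) (QuotMod L) := by
  intro U V hUV
  by_contra! hne
  -- The preimages of the two summands are principal; their generators would decompose `L`.
  obtain ⟨L₁, h₁⟩ := exists_eq_leftIdeal (U.comap (leftIdeal L).mkQ)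
  obtain ⟨L₂, h₂⟩ := exists_eq_leftIdeal (V.comap (leftIdeal L).mkQ)
  have hsurj := (leftIdeal L).mkQ_surjective
  have hmap : ∀ W : Submodule (DiffOp F) (QuotMod L),
      (W.comap (leftIdeal L).mkQ).map (leftIdeal L).mkQ = W := fun W =>
    Submodule.map_comap_eq_of_surjective hsurj W
  have aux : ∀ (W : Submodule (DiffOp F) (QuotMod L)) (P : DiffOp F),
      W.comap (leftIdeal L).mkQ = leftIdeal P → W ≠ ⊥ → W ≠ ⊤ → P ∉ Set.range (C (F := F)) := by
    rintro W _ hW hb ht ⟨a, rfl⟩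
    rcases leftIdeal_C_eq a with h | h
    · apply hb
      rw [← hmap W, hW, h, Submodule.map_bot]
    · apply ht
      rw [← hmap W, hW, h, Submodule.map_top, LinearMap.range_eq_top.mpr hsurj]
  have hUt : U ≠ ⊤ := fun h => hne.2 (by
    have := hUV.inf_eq_bot
    rwa [h, top_inf_eq] at this)
  have hVt : V ≠ ⊤ := fun h => hne.1 (by
    have := hUV.inf_eq_bot
    rwa [h, inf_top_eq] at this)
  refine hL ⟨L₁, L₂, aux U L₁ h₁ hne.1 hUt, aux V L₂ h₂ hne.2 hVt, ?_, ?_⟩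
  · rw [IsGCRD, ← h₁, ← h₂, ← map_one C, (leftIdeal_C_eq 1).resolve_left]
    · symm
      -- Pulling `U ⊔ V = ⊤` back adds the kernel `leftIdeal L`, which the preimage of `U` already
      -- contains.
      have hle : leftIdeal L ≤ U.comap (leftIdeal L).mkQ := by
        conv_lhs => rw [← Submodule.ker_mkQ (leftIdeal L)]
        exact LinearMap.ker_le_comap _
      have h3 : (U.comap (leftIdeal L).mkQ ⊔ V.comap (leftIdeal L).mkQ).map (leftIdeal L).mkQ =
          ⊤ := by
        rw [Submodule.map_sup, hmap, hmap, hUV.sup_eq_top]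
      have h4 := congrArg (Submodule.comap (leftIdeal L).mkQ) h3
      rwa [Submodule.comap_map_mkQ, Submodule.comap_top,
        sup_eq_right.mpr (hle.trans le_sup_left)] at h4
    · intro h
      have : C (1 : RatFunc F) ∈ leftIdeal (C (1 : RatFunc F)) :=
        Submodule.mem_span_singleton_self _
      rw [h, Submodule.mem_bot, map_one] at this
      exact one_ne_zero this
  · rw [IsLCLM, ← h₁, ← h₂, ← Submodule.comap_inf, hUV.inf_eq_bot, Submodule.comap_bot,
      Submodule.ker_mkQ]

end DiffOp

end

noncomputable section

namespace DiffOp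

variable {F : Type*} [Field F]

/-! ### The central subring `C[∂ᵖ]` over the field `C` of constants -/

theorem ratDeriv_X : ratDeriv F RatFunc.X = 1 := by
  have h := ratDeriv_div (F := F) Polynomial.X 1 one_ne_zero
  simpa [RatFunc.algebraMap_X] using h

/-- The field of constants of `d/dt`. -/
def constants (F : Type*) [Field F] : Subfield (RatFunc F) where
  carrier := {a | ratDeriv F a = 0}
  mul_mem' {a b} ha hb := by
    rw [Set.mem_ofPred_eq] at *
    rw [Derivation.leibniz, ha, hb, smul_zero, smul_zero, add_zero]
  one_mem' := Derivation.map_one_eq_zero _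
  add_mem' {a b} ha hb := by
    rw [Set.mem_ofPred_eq] at *
    rw [map_add, ha, hb, add_zero]
  zero_mem' := map_zero _
  neg_mem' {a} ha := by
    rw [Set.mem_ofPred_eq] at *
    rw [map_neg, ha, neg_zero]
  inv_mem' a ha := by
    rw [Set.mem_ofPred_eq] at *
    by_cases h : a = 0
    · rw [h, inv_zero, map_zero]
    · have h1 : ratDeriv F (a * a⁻¹) = 0 := by
        rw [mul_inv_cancel₀ h, Derivation.map_one_eq_zero]
      rw [Derivation.leibniz, ha, smul_zero, add_zero, smul_eq_mul] at h1
      exact (mul_eq_zero.mp h1).resolve_left h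

theorem mem_constants {a : RatFunc F} : a ∈ constants F ↔ ratDeriv F a = 0 := Iff.rfl

theorem coeff_D_mul (x : DiffOp F) (i : ℕ) :
    (D * x).coeff i = ratDeriv F (x.coeff i) + if i = 0 then 0 else x.coeff (i - 1) := by
  rw [D_mul, coeff_dLeft]

theorem coeff_mul_D (x : DiffOp F) (i : ℕ) :
    (x * D).coeff i = if i = 0 then 0 else x.coeff (i - 1) := by
  have h : x * D = x.coeff.sum fun i a => mono (i + 1) a := by
    conv_lhs => rw [eq_sum x]
    rw [Finsupp.sum, Finset.sum_mul]
    refine Finset.sum_congr rfl fun j _ => ?_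
    rw [smul_mul_assoc, ← pow_succ, D_pow, smul_mono, mul_one]
  rw [h]
  have h2 : ∀ s : Finset ℕ, (∑ j ∈ s, mono (j + 1) (x.coeff j)).coeff i =
      ∑ j ∈ s, (mono (j + 1) (x.coeff j)).coeff i := fun s => by
    induction s using Finset.cons_induction with
    | empty => rfl
    | cons a s ha ih => rw [Finset.sum_cons, Finset.sum_cons, coeff_add, ih]
  rw [Finsupp.sum, h2]
  simp only [coeff_mono_apply]
  split_ifs with hi
  · exact Finset.sum_eq_zero fun j _ => if_neg (by omega)
  · rw [Finset.sum_eq_single (i - 1), if_pos (by omega)]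
    · exact fun j _ hj => if_neg (by omega)
    · intro hj
      rw [if_pos (by omega)]
      exact Finsupp.notMem_support_iff.mp hj

theorem D_pow_mul_X (i : ℕ) :
    (D : DiffOp F) ^ i * C RatFunc.X = C RatFunc.X * D ^ i + (i : DiffOp F) * D ^ (i - 1) := by
  induction i with
  | zero => simp
  | succ i ih =>
    rw [pow_succ', mul_assoc, ih, mul_add, ← mul_assoc, D_mul_C, ratDeriv_X, map_one, add_mul,
      one_mul, mul_assoc, ← pow_succ', add_assoc, ← mul_assoc D, ← Nat.cast_comm, mul_assoc,
      ← pow_succ', Nat.cast_succ, add_mul, one_mul, Nat.add_sub_cancel, add_comm (D ^ i)]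
    rcases i with _ | i
    · simp
    · rw [Nat.succ_sub_one]

/-- The commutator with `t` is formal differentiation with respect to `∂`. It lowers the order and,
in characteristic `p`, detects the exponents not divisible by `p`. -/
theorem coeff_mul_X (x : DiffOp F) (i : ℕ) :
    (x * C RatFunc.X).coeff i =
      (C RatFunc.X * x).coeff i + ((i + 1 : ℕ) : RatFunc F) * x.coeff (i + 1) := by
  have h : x * C RatFunc.X = C RatFunc.X * x +
      x.coeff.sum fun i a => mono (i - 1) ((i : RatFunc F) * a) := by
    conv_lhs => rw [eq_sum x]
    conv_rhs => enter [1]; rw [eq_sum x]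
    rw [Finsupp.sum, Finsupp.sum, Finset.sum_mul, Finset.mul_sum, ← Finset.sum_add_distrib]
    refine Finset.sum_congr rfl fun j _ => ?_
    rw [smul_mul_assoc, D_pow_mul_X, smul_add, ← smul_eq, ← map_natCast C, ← smul_eq, smul_smul,
      smul_smul, mul_comm, ← smul_smul, D_pow (j - 1), smul_mono, mul_one,
      mul_comm (x.coeff j) (j : RatFunc F), smul_eq]
  rw [h, coeff_add]
  congr 1
  have h2 : ∀ s : Finset ℕ, (∑ j ∈ s, mono (j - 1) ((j : RatFunc F) * x.coeff j)).coeff i =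
      ∑ j ∈ s, (mono (j - 1) ((j : RatFunc F) * x.coeff j)).coeff i := fun s => by
    induction s using Finset.cons_induction with
    | empty => rfl
    | cons a s ha ih => rw [Finset.sum_cons, Finset.sum_cons, coeff_add, ih]
  rw [Finsupp.sum, h2]
  simp only [coeff_mono_apply]
  rw [Finset.sum_eq_single (i + 1), if_pos (by omega)]
  · intro j _ hj
    rcases j with _ | j
    · simp
    · rw [if_neg (by omega)]
  · intro hj
    rw [if_pos (by omega), Finsupp.notMem_support_iff.mp hj, mul_zero]

variable (p : ℕ) [Fact p.Prime] [CharP F p]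

/-- Evaluation of polynomials at `∂ᵖ`. -/
def evalDPow : Polynomial (RatFunc F) →+* DiffOp F :=
  Polynomial.eval₂RingHom' C (D ^ p) fun a => (D_pow_char_mul_C p a).symm

/-- Evaluation of polynomials with constant coefficients at `∂ᵖ`. -/
def central : Polynomial (constants F) →+* DiffOp F :=
  (evalDPow p).comp (Polynomial.mapRingHom (constants F).subtype)

theorem evalDPow_monomial (n : ℕ) (a : RatFunc F) :
    evalDPow p (Polynomial.monomial n a) = mono (p * n) a := by
  have : evalDPow p (Polynomial.monomial n a) = C a * (D ^ p) ^ n :=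
    Polynomial.eval₂_monomial _ _
  rw [this, ← smul_eq, ← pow_mul, D_pow, smul_mono, mul_one]

theorem central_monomial (n : ℕ) (a : constants F) :
    central p (Polynomial.monomial n a) = mono (p * n) (a : RatFunc F) := by
  rw [central, RingHom.comp_apply, Polynomial.coe_mapRingHom, Polynomial.map_monomial,
    evalDPow_monomial]
  rfl

theorem coeff_central (f : Polynomial (constants F)) (i : ℕ) :
    (central p f).coeff (p * i) = f.coeff i := by
  have hp : 0 < p := (Fact.out : p.Prime).pos
  induction f using Polynomial.induction_on' with
  | add f g hf hg => rw [map_add, coeff_add, hf, hg, Polynomial.coeff_add]; rfl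
  | monomial n a =>
    rw [central_monomial, coeff_mono_apply, Polynomial.coeff_monomial]
    by_cases h : n = i
    · rw [if_pos h, if_pos (by rw [h])]
    · rw [if_neg h, if_neg (fun h' => h (Nat.eq_of_mul_eq_mul_left hp h'))]
      rfl

theorem central_injective : Function.Injective (central p (F := F)) := by
  intro f g h
  ext i
  rw [← coeff_central p f, h, coeff_central]

theorem commute_of_commute_C_of_commute_D {x : DiffOp F} (h : ∀ a, Commute x (C a))
    (hD : Commute x D) (y : DiffOp F) : Commute x y := by
  rw [eq_sum y]
  refine Commute.sum_right _ _ _ fun i _ => ?_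
  beta_reduce
  rw [smul_eq]
  exact (h _).mul_right (hD.pow_right i)

theorem commute_central (f : Polynomial (constants F)) (x : DiffOp F) :
    Commute (central p f) x := by
  refine commute_of_commute_C_of_commute_D (fun a => ?_) ?_ x
  · induction f using Polynomial.induction_on' with
    | add f g hf hg => rw [map_add]; exact hf.add_left hg
    | monomial n c =>
      rw [central_monomial, ← mul_one (c : RatFunc F), ← smul_mono, ← D_pow, smul_eq, pow_mul]
      refine Commute.mul_left ?_ (Commute.pow_left (D_pow_char_mul_C p a) n)
      rw [commute_iff_eq, ← map_mul, mul_comm, map_mul]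
  · induction f using Polynomial.induction_on' with
    | add f g hf hg => rw [map_add]; exact hf.add_left hg
    | monomial n c =>
      rw [central_monomial, ← mul_one (c : RatFunc F), ← smul_mono, ← D_pow, smul_eq]
      refine Commute.mul_left ?_ (Commute.pow_left (Commute.refl D) _)
      rw [commute_iff_eq, D_mul_C, mem_constants.mp c.2, map_zero, add_zero]

/-- The center of `F(t)⟨∂⟩` is `C[∂ᵖ]`. -/
theorem exists_eq_central {x : DiffOp F} (hX : x * C RatFunc.X = C RatFunc.X * x)
    (hD : D * x = x * D) : ∃ f, x = central p f := by
  have hp : p ≠ 0 := (Fact.out : p.Prime).ne_zero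
  have hchar : CharP (RatFunc F) p :=
    charP_of_injective_algebraMap (algebraMap F (RatFunc F)).injective p
  -- The commutator with `∂` differentiates each coefficient.
  have hc : ∀ i, x.coeff i ∈ constants F := by
    intro i
    have := congrArg (fun y => y.coeff i) hD
    simp only [coeff_D_mul, coeff_mul_D] at this
    exact mem_constants.mpr (by simpa using this)
  have h0 : ∀ i, ¬ p ∣ i → x.coeff i = 0 := by
    intro i hi
    obtain ⟨j, rfl⟩ : ∃ j, i = j + 1 := ⟨i - 1, by
      have : i ≠ 0 := by
        rintro rfl
        exact hi (dvd_zero p)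
      omega⟩
    have := coeff_mul_X x j
    rw [hX, left_eq_add, mul_eq_zero, CharP.cast_eq_zero_iff (RatFunc F) p] at this
    exact this.resolve_left hi
  obtain ⟨n, hn⟩ := exists_mem_orderLT x
  refine ⟨∑ i ∈ Finset.range n, Polynomial.monomial i ⟨x.coeff (p * i), hc _⟩, ?_⟩
  refine ext_coeff fun j => ?_
  by_cases hj : p ∣ j
  · obtain ⟨i, rfl⟩ := hj
    rw [coeff_central, Polynomial.finsetSum_coeff]
    simp only [Polynomial.coeff_monomial]
    rw [Finset.sum_ite_eq']
    split_ifs with hi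
    · rfl
    · refine hn _ ?_
      rw [Finset.mem_range, not_lt] at hi
      exact hi.trans (Nat.le_mul_of_pos_left i (Nat.pos_of_ne_zero hp))
  · rw [h0 j hj]
    symm
    have h2 : ∀ f : Polynomial (constants F), (central p f).coeff j = 0 := by
      intro f
      induction f using Polynomial.induction_on' with
      | add f g hf hg => rw [map_add, coeff_add, hf, hg, add_zero]
      | monomial n a =>
        rw [central_monomial, coeff_mono_apply, if_neg]
        rintro rfl
        exact hj (dvd_mul_right p n)
    exact h2 _

/-- Nonzero two-sided ideals are generated by central elements. -/
theorem exists_eq_leftIdeal_central {I : Submodule (DiffOp F) (DiffOp F)} (hI : I ≠ ⊥)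
    (hr : ∀ x ∈ I, ∀ y, x * y ∈ I) : ∃ f, I = leftIdeal (central p f) := by
  obtain ⟨g, n, rfl, hg, hg1, hmin⟩ := exists_monic_generator hI
  have hgI : g ∈ leftIdeal g := Submodule.mem_span_singleton_self g
  -- Both commutators lie in the ideal and have order below that of `g`, hence vanish. For `∂` this
  -- uses that the leading coefficient is `1`.
  have h1 : g * C RatFunc.X - C RatFunc.X * g = 0 := by
    refine hmin _ (Submodule.sub_mem _ (hr _ hgI _) (Submodule.smul_mem _ _ hgI)) fun i hi => ?_
    rw [coeff_sub, coeff_mul_X, add_sub_cancel_left, hg _ (by omega), mul_zero]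
  have h2 : D * g - g * D = 0 := by
    refine hmin _ (Submodule.sub_mem _ (Submodule.smul_mem _ _ hgI) (hr _ hgI _)) fun i hi => ?_
    rw [coeff_sub, coeff_D_mul, coeff_mul_D, add_sub_cancel_right]
    rcases hi.eq_or_lt with rfl | hi
    · rw [hg1, Derivation.map_one_eq_zero]
    · rw [hg _ hi, map_zero]
  obtain ⟨f, rfl⟩ := exists_eq_central p (sub_eq_zero.mp h1) (sub_eq_zero.mp h2)
  exact ⟨f, rfl⟩

/-- A left divisor of a nonzero central element divides it in `C[∂ᵖ]` if the cofactor is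
central. -/
theorem dvd_of_mul_central_eq {f g : Polynomial (constants F)} {q : DiffOp F} (hf : f ≠ 0)
    (h : q * central p f = central p g) : f ∣ g := by
  have hf0 : central p f ≠ 0 := fun h0 => hf (central_injective p (by rw [h0, map_zero]))
  -- The cofactor is central: after right multiplication by `central p f`, both sides become the
  -- product of `x` and the central `central p g`, and `F(t)⟨∂⟩` is a domain.
  have hq : ∀ x, q * x = x * q := by
    intro x
    apply mul_right_cancel₀ hf0
    rw [mul_assoc, ← (commute_central p f x).eq, ← mul_assoc, h, mul_assoc, h,
      (commute_central p g x).eq]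
  obtain ⟨k, rfl⟩ := exists_eq_central p (hq _) (hq _).symm
  rw [← map_mul] at h
  exact ⟨k, by rw [← central_injective p h, mul_comm]⟩

instance isTwoSided_leftIdeal_central (f : Polynomial (constants F)) :
    Ideal.IsTwoSided (leftIdeal (central p f)) where
  mul_mem_of_left {a} b ha := by
    obtain ⟨q, rfl⟩ := mem_leftIdeal.mp ha
    exact mem_leftIdeal.mpr ⟨q * b, by rw [mul_assoc, mul_assoc, (commute_central p f b).eq]⟩

/-! ### The quotients of `F(t)⟨∂⟩` by central elements -/

/-- The preimage of a two-sided ideal is generated by a central `f` dividing `N`. Either `f` is a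
unit and the ideal is everything, or the cofactor is a unit and the ideal is zero. -/
theorem isSimpleRing_quotient {N : Polynomial (constants F)} (hN : Irreducible N) :
    IsSimpleRing (DiffOp F ⧸ leftIdeal (central p N)) := by
  set mk := Ideal.Quotient.mk (leftIdeal (central p N))
  have hmk : ∀ x, mk x = 0 ↔ x ∈ leftIdeal (central p N) := fun x =>
    Ideal.Quotient.eq_zero_iff_mem
  have hnt : Nontrivial (DiffOp F ⧸ leftIdeal (central p N)) := by
    refine Ideal.Quotient.nontrivial_iff.mpr fun h => hN.not_isUnit ?_
    have h1 : (1 : DiffOp F) ∈ leftIdeal (central p N) := by rw [h]; trivial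
    obtain ⟨q, hq⟩ := mem_leftIdeal.mp h1
    exact isUnit_of_dvd_one (dvd_of_mul_central_eq p hN.ne_zero (by rw [hq, map_one]))
  refine ⟨⟨fun T => ?_⟩⟩
  let I : Submodule (DiffOp F) (DiffOp F) :=
    { carrier := {x | mk x ∈ T}
      add_mem' := fun {x y} hx hy => by
        rw [Set.mem_ofPred_eq, map_add]
        exact T.add_mem hx hy
      zero_mem' := by
        rw [Set.mem_ofPred_eq, map_zero]
        exact T.zero_mem
      smul_mem' := fun c x hx => by
        rw [Set.mem_ofPred_eq, smul_eq_mul, map_mul]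
        exact T.mul_mem_left _ _ hx }
  have hI : ∀ x, x ∈ I ↔ mk x ∈ T := fun _ => Iff.rfl
  have hNI : central p N ∈ I := by
    rw [hI, (hmk _).mpr (Submodule.mem_span_singleton_self _)]
    exact T.zero_mem
  have hN0 : central p N ≠ 0 := fun h => hN.ne_zero (central_injective p (by rw [h, map_zero]))
  obtain ⟨f, hf⟩ := exists_eq_leftIdeal_central p (I := I)
    (fun h => hN0 (by rwa [h, Submodule.mem_bot] at hNI)) (fun x hx y => by
      rw [hI, map_mul]
      exact T.mul_mem_right _ _ hx)
  obtain ⟨q, hq⟩ := mem_leftIdeal.mp (hf ▸ hNI)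
  have hf0 : f ≠ 0 := by
    rintro rfl
    rw [map_zero, mul_zero] at hq
    exact hN0 hq.symm
  obtain ⟨g, hg⟩ := dvd_of_mul_central_eq p hf0 hq
  rcases hN.isUnit_or_isUnit hg with hu | hu
  · right
    obtain ⟨v, hv⟩ := hu.exists_left_inv
    have h1 : (1 : DiffOp F) ∈ I := by
      rw [hf, mem_leftIdeal]
      exact ⟨central p v, by rw [← map_mul, hv, map_one]⟩
    rw [hI, map_one] at h1
    exact TwoSidedIdeal.one_mem_iff T |>.mp h1
  · left
    obtain ⟨v, hv⟩ := hu.exists_right_inv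
    rw [eq_bot_iff]
    intro x hx
    obtain ⟨x, rfl⟩ := Ideal.Quotient.mk_surjective x
    rw [TwoSidedIdeal.mem_bot]
    refine (hmk _).mpr ?_
    have hxI : x ∈ I := hx
    obtain ⟨r, rfl⟩ := mem_leftIdeal.mp (hf ▸ hxI)
    refine mem_leftIdeal.mpr ⟨r * central p v, ?_⟩
    rw [mul_assoc, ← map_mul, hg, mul_comm v, mul_assoc, hv, mul_one]

/-- Left ideals are `F(t)`-subspaces of a finite-dimensional space. -/
theorem isArtinianRing_quotient {f : Polynomial (constants F)} (hf : f ≠ 0) :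
    IsArtinianRing (DiffOp F ⧸ leftIdeal (central p f)) := by
  have hf0 : central p f ≠ 0 := fun h => hf (central_injective p (by rw [h, map_zero]))
  have := finite_quotMod _ hf0
  have : IsScalarTower (RatFunc F) (DiffOp F ⧸ leftIdeal (central p f))
      (DiffOp F ⧸ leftIdeal (central p f)) := ⟨fun a x y => by
    obtain ⟨x, rfl⟩ := Ideal.Quotient.mk_surjective x
    obtain ⟨y, rfl⟩ := Ideal.Quotient.mk_surjective y
    exact congrArg (Ideal.Quotient.mk (leftIdeal (central p f))) (smul_mul_assoc a x y)⟩
  exact isArtinian_of_tower (RatFunc F) inferInstance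

/-- The preimage of a left ideal is generated by some `a` with `b a = f` central. If `g` sends the
class of `a` to that of `y`, then `b y = c f = f c = b a c`. Cancelling `b` gives `y = a c`, so `g`
is right multiplication by `c` and extends to the whole ring. -/
theorem baer_quotient {f : Polynomial (constants F)} (hf : f ≠ 0) :
    Module.Baer (DiffOp F ⧸ leftIdeal (central p f)) (DiffOp F ⧸ leftIdeal (central p f)) := by
  intro I g
  set mk := Ideal.Quotient.mk (leftIdeal (central p f))
  have hmk : ∀ x, mk x = 0 ↔ x ∈ leftIdeal (central p f) := fun x =>
    Ideal.Quotient.eq_zero_iff_mem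
  have hf0 : central p f ≠ 0 := fun h => hf (central_injective p (by rw [h, map_zero]))
  obtain ⟨a, ha⟩ := exists_eq_leftIdeal (Ideal.comap mk I)
  have hmem : ∀ x, mk x ∈ I ↔ ∃ q, q * a = x := fun x => by
    rw [← mem_leftIdeal, ← ha, Ideal.mem_comap]
  have haI : mk a ∈ I := (hmem a).mpr ⟨1, one_mul a⟩
  obtain ⟨b, hb⟩ := (hmem (central p f)).mp (by
    rw [(hmk _).mpr (Submodule.mem_span_singleton_self _)]
    exact I.zero_mem)
  have hb0 : b ≠ 0 := by
    rintro rfl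
    exact hf0 (by rw [← hb, zero_mul])
  obtain ⟨y, hy⟩ := Ideal.Quotient.mk_surjective (g ⟨mk a, haI⟩)
  have h1 : mk (b * y) = 0 := by
    rw [map_mul, hy, ← smul_eq_mul, ← map_smul]
    have : mk b • (⟨mk a, haI⟩ : I) = 0 := by
      apply Subtype.ext
      change mk b * mk a = 0
      rw [← map_mul, hb, hmk]
      exact Submodule.mem_span_singleton_self _
    rw [this, map_zero]
  obtain ⟨c, hc⟩ := mem_leftIdeal.mp ((hmk _).mp h1)
  have h2 : y = a * c := by
    apply mul_left_cancel₀ hb0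
    rw [← mul_assoc, hb, (commute_central p f c).eq, hc]
  refine ⟨LinearMap.toSpanSingleton _ _ (mk c), fun x hx => ?_⟩
  obtain ⟨x, rfl⟩ := Ideal.Quotient.mk_surjective x
  obtain ⟨q, rfl⟩ := (hmem x).mp hx
  have h3 : (⟨mk (q * a), hx⟩ : I) = mk q • ⟨mk a, haI⟩ := Subtype.ext (map_mul mk q a)
  change _ = g (⟨mk (q * a), hx⟩ : I)
  rw [h3, map_smul, ← hy, h2, LinearMap.toSpanSingleton_apply, smul_eq_mul, smul_eq_mul]
  change mk (q * a) * mk c = _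
  rw [← map_mul, ← map_mul, mul_assoc]

end DiffOp

end

/-! ### Characteristic polynomials and annihilating polynomials -/

noncomputable section

/-- The factor theorem for the commuting matrices `X` and `A`: `X - A` divides `Xᵏ - Aᵏ`. -/
theorem Matrix.charmatrix_dvd_smul_one_sub {R n : Type*} [CommRing R] [Fintype n] [DecidableEq n]
    (A : Matrix n n R) (g : Polynomial R) :
    A.charmatrix ∣ g • (1 : Matrix n n (Polynomial R)) -
      Polynomial.C.mapMatrix (Polynomial.aeval A g) := by
  induction g using Polynomial.induction_on' with
  | add f g hf hg =>
    rw [add_smul, map_add, map_add, add_sub_add_comm]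
    exact dvd_add hf hg
  | monomial k a =>
    have h1 := (Matrix.scalar_commute (Polynomial.X : Polynomial R) (fun r => Commute.all _ r)
      (Polynomial.C.mapMatrix A)).sub_dvd_pow_sub_pow k
    have h2 : (Polynomial.monomial k a) • (1 : Matrix n n (Polynomial R)) -
        Polynomial.C.mapMatrix (Polynomial.aeval A (Polynomial.monomial k a)) =
        (Matrix.scalar n (Polynomial.X : Polynomial R) ^ k - Polynomial.C.mapMatrix A ^ k) *
          Matrix.scalar n (Polynomial.C a) := by
      rw [Polynomial.aeval_monomial, map_mul, sub_mul, map_pow, ← map_pow (Matrix.scalar n),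
        ← map_mul, mul_comm, Polynomial.C_mul_X_pow_eq_monomial, Matrix.scalar_apply,
        Matrix.smul_one_eq_diagonal]
      congr 1
      have h3 : Polynomial.C.mapMatrix (algebraMap R (Matrix n n R) a) =
          Matrix.diagonal fun _ : n => (Polynomial.C a : Polynomial R) := by
        rw [Matrix.algebraMap_eq_diagonal, RingHom.mapMatrix_apply,
          Matrix.diagonal_map (map_zero _)]
        rfl
      rw [h3, ← Matrix.scalar_apply]
      exact (Matrix.scalar_commute _ (fun r => Commute.all _ r) _).eq
    rw [h2]
    exact h1.mul_right _

/-- If `g` annihilates a matrix, the characteristic polynomial divides a power of `g`. -/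
theorem Matrix.charpoly_dvd_pow_of_aeval_eq_zero {R n : Type*} [CommRing R] [Fintype n]
    [DecidableEq n] (A : Matrix n n R) {g : Polynomial R} (h : Polynomial.aeval A g = 0) :
    A.charpoly ∣ g ^ Fintype.card n := by
  obtain ⟨B, hB⟩ := A.charmatrix_dvd_smul_one_sub g
  rw [h, map_zero, sub_zero] at hB
  -- With `g(A) = 0` the charmatrix divides the scalar matrix `g`, whose determinant is a power of
  -- `g`.
  have h3 := congrArg Matrix.det hB
  rw [Matrix.det_mul, Matrix.det_smul, Matrix.det_one, mul_one] at h3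
  exact ⟨_, h3⟩

theorem LinearMap.charpoly_dvd_pow_of_aeval_eq_zero {K V : Type*} [Field K] [AddCommGroup V]
    [Module K V] [Module.Finite K V] (φ : V →ₗ[K] V) {g : Polynomial K}
    (h : Polynomial.aeval φ g = 0) : ∃ n, φ.charpoly ∣ g ^ n := by
  let b := Module.Free.chooseBasis K V
  rw [← φ.charpoly_toMatrix b]
  refine ⟨_, Matrix.charpoly_dvd_pow_of_aeval_eq_zero (LinearMap.toMatrixAlgEquiv b φ) ?_⟩
  rw [Polynomial.aeval_algHom_apply, h, map_zero]

namespace DiffOp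

variable {F : Type*} [Field F] (p : ℕ) [Fact p.Prime] [CharP F p]

/-! ### Modules annihilated by central elements -/

theorem pCurvature_apply (L : DiffOp F) (x : QuotMod L) :
    pCurvature p L x = (D ^ p : DiffOp F) • x := rfl

/-- Links module structure and linear algebra: polynomials in `∂ᵖ` act as polynomials in the
`p`-curvature. -/
theorem evalDPow_smul (L : DiffOp F) (g : Polynomial (RatFunc F)) (x : QuotMod L) :
    evalDPow p g • x = Polynomial.aeval (pCurvature p L) g x := by
  have hpow : ∀ n x, ((D ^ p : DiffOp F) ^ n) • x = (pCurvature p L ^ n) x := by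
    intro n
    induction n with
    | zero => intro x; simp
    | succ n ih =>
      intro x
      rw [pow_succ, pow_succ, mul_smul, ih]
      rfl
  induction g using Polynomial.induction_on' with
  | add f g hf hg => rw [map_add, map_add, add_smul, hf, hg, LinearMap.add_apply]
  | monomial n a =>
    rw [evalDPow_monomial, ← mul_one a, ← smul_mono, ← D_pow, smul_eq, mul_smul, C_smul_quot,
      pow_mul, hpow, Polynomial.aeval_monomial, mul_one, Module.algebraMap_end_eq_smul_id,
      smul_mul_assoc]
    rfl

theorem central_smul (L : DiffOp F) (f : Polynomial (constants F)) (x : QuotMod L) :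
    central p f • x = Polynomial.aeval (pCurvature p L) (f.map (constants F).subtype) x := by
  rw [central, RingHom.comp_apply, Polynomial.coe_mapRingHom, evalDPow_smul]

theorem exists_central_annihilator {L : DiffOp F} (hL : L ≠ 0) :
    ∃ f : Polynomial (constants F), f ≠ 0 ∧ ∀ x : QuotMod L, central p f • x = 0 := by
  have hchar : CharP (RatFunc F) p :=
    charP_of_injective_algebraMap (algebraMap F (RatFunc F)).injective p
  have hfin := finite_quotMod L hL
  let φ : RatFunc F →+* constants F := (frobenius (RatFunc F) p).codRestrict (constants F)
    fun a => by
      rw [mem_constants, frobenius_def, Derivation.leibniz_pow]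
      simp
  have hφ : (constants F).subtype.comp φ = frobenius (RatFunc F) p := rfl
  set χ := (pCurvature p L).charpoly
  -- A `p`-th power in `F(t)` has derivative zero, so Frobenius lands in the constants and `χ ^ p`
  -- is a polynomial over them.
  have h1 : (Polynomial.expand _ p (χ.map φ)).map (constants F).subtype = χ ^ p := by
    rw [Polynomial.map_expand, Polynomial.map_map, hφ, ← Polynomial.map_expand,
      Polynomial.map_frobenius_expand]
  refine ⟨Polynomial.expand _ p (χ.map φ), fun h => ?_, fun x => ?_⟩
  · rw [h, Polynomial.map_zero] at h1
    exact pow_ne_zero p (pCurvature p L).charpoly_monic.ne_zero h1.symm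
  · rw [central_smul, h1, map_pow, LinearMap.aeval_self_charpoly,
      zero_pow (Fact.out : p.Prime).ne_zero, LinearMap.zero_apply]

variable {M : Type*} [AddCommGroup M] [Module (DiffOp F) M]

theorem central_smul_comm (f : Polynomial (constants F)) (a : DiffOp F) (x : M) :
    central p f • a • x = a • central p f • x := by
  rw [smul_smul, (commute_central p f a).eq, mul_smul]

/-- Multiplication by a central element. -/
def centralSMul (M : Type*) [AddCommGroup M] [Module (DiffOp F) M]
    (f : Polynomial (constants F)) : M →ₗ[DiffOp F] M where
  toFun x := central p f • x
  map_add' := smul_add _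
  map_smul' a x := central_smul_comm p f a x

theorem centralSMul_apply (f : Polynomial (constants F)) (x : M) :
    centralSMul p M f x = central p f • x := rfl

/-! ### Primary decomposition and the exponent -/

theorem smul_eq_zero_or_of_isCoprime (hM : IsIndecomposableModule (DiffOp F) M)
    {f g : Polynomial (constants F)} (hfg : IsCoprime f g)
    (h : ∀ x : M, central p (f * g) • x = 0) :
    (∀ x : M, central p f • x = 0) ∨ ∀ x : M, central p g • x = 0 := by
  obtain ⟨u, v, huv⟩ := hfg
  have hone : ∀ x : M, central p u • central p f • x + central p v • central p g • x = x := by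
    intro x
    rw [smul_smul, smul_smul, ← add_smul, ← map_mul, ← map_mul, ← map_add, huv, map_one, one_smul]
  -- Bézout splits `M` into the kernels of `f` and `g`.
  have hcompl : IsCompl (LinearMap.ker (centralSMul p M f)) (LinearMap.ker (centralSMul p M g)) := by
    refine ⟨Submodule.disjoint_def.mpr fun x hx hx' => ?_,
      codisjoint_iff.mpr (Submodule.eq_top_iff'.mpr fun x => Submodule.mem_sup.mpr
        ⟨central p v • central p g • x, ?_, central p u • central p f • x, ?_, ?_⟩)⟩
    · rw [LinearMap.mem_ker, centralSMul_apply] at hx hx'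
      rw [← hone x, hx, hx', smul_zero, smul_zero, add_zero]
    · rw [LinearMap.mem_ker, centralSMul_apply, central_smul_comm, smul_smul (central p f),
        ← map_mul, h, smul_zero]
    · rw [LinearMap.mem_ker, centralSMul_apply, central_smul_comm, smul_smul (central p g),
        ← map_mul, mul_comm, h, smul_zero]
    · rw [add_comm, hone]
  rcases hM _ _ hcompl with h0 | h0
  · right
    have := hcompl.sup_eq_top
    rw [h0, bot_sup_eq] at this
    intro x
    exact LinearMap.mem_ker.mp (this ▸ Submodule.mem_top : x ∈ LinearMap.ker (centralSMul p M g))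
  · left
    have := hcompl.sup_eq_top
    rw [h0, sup_bot_eq] at this
    intro x
    exact LinearMap.mem_ker.mp (this ▸ Submodule.mem_top : x ∈ LinearMap.ker (centralSMul p M f))

/-- `k` is the exact exponent of the annihilator `N ^ k` of `M`. -/
def HasExponent (M : Type*) [AddCommGroup M] [Module (DiffOp F) M]
    (N : Polynomial (constants F)) (k : ℕ) : Prop :=
  (∀ x : M, central p N ^ k • x = 0) ∧ ∃ x : M, central p N ^ (k - 1) • x ≠ 0

theorem exists_hasExponent [Nontrivial M] (hM : IsIndecomposableModule (DiffOp F) M)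
    {f : Polynomial (constants F)} (hf : f ≠ 0) (h : ∀ x : M, central p f • x = 0) :
    ∃ (N : Polynomial (constants F)) (k : ℕ), Irreducible N ∧ HasExponent p M N k := by
  classical
  have key : ∃ (N : Polynomial (constants F)) (k : ℕ),
      Irreducible N ∧ ∀ x : M, central p N ^ k • x = 0 := by
    induction f using UniqueFactorizationMonoid.induction_on_coprime with
    | h0 => exact absurd rfl hf
    | h1 hu =>
      obtain ⟨x, hx⟩ := exists_ne (0 : M)
      obtain ⟨v, hv⟩ := hu.exists_left_inv
      refine absurd ?_ hx
      rw [← one_smul (DiffOp F) x, ← map_one (central p), ← hv, map_mul, mul_smul, h, smul_zero]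
    | hpr i hN => exact ⟨_, i, hN.irreducible, by simpa only [map_pow] using h⟩
    | hcp hxy ihx ihy =>
      rcases smul_eq_zero_or_of_isCoprime p hM hxy.isCoprime h with h1 | h1
      · exact ihx (left_ne_zero_of_mul hf) h1
      · exact ihy (right_ne_zero_of_mul hf) h1
  obtain ⟨N, hk⟩ := key
  have hN := hk.choose_spec.1
  replace hk : ∃ k, ∀ x : M, central p N ^ k • x = 0 := ⟨_, hk.choose_spec.2⟩
  refine ⟨N, Nat.find hk, hN, Nat.find_spec hk, ?_⟩
  -- Exponent `0` would make the identity act as zero on a nontrivial module; positivity makes `k -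
  -- 1` a genuine predecessor.
  have h0 : Nat.find hk ≠ 0 := by
    intro h0
    have h1 := Nat.find_spec hk
    obtain ⟨x, hx⟩ := exists_ne (0 : M)
    rw [h0] at h1
    apply hx
    simpa using h1 x
  have := Nat.find_min hk (m := Nat.find hk - 1) (by omega)
  push Not at this
  exact this

/-- At `k = 0` the truncated `k - 1` is again `0`, and the two clauses contradict each other. -/
theorem HasExponent.ne_zero {N : Polynomial (constants F)} {k : ℕ} (h : HasExponent p M N k) :
    k ≠ 0 := by
  rintro rfl
  obtain ⟨x, hx⟩ := h.2
  exact hx (h.1 x)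

theorem isTorsionBySet_of_hasExponent {N : Polynomial (constants F)} {k : ℕ}
    (h : HasExponent p M N k) :
    Module.IsTorsionBySet (DiffOp F) M (leftIdeal (central p (N ^ k)) : Set (DiffOp F)) := by
  rintro x ⟨a, ha⟩
  obtain ⟨q, rfl⟩ := mem_leftIdeal.mp ha
  change (q * _) • x = 0
  rw [mul_smul, map_pow, h.1, smul_zero]

/-- The reduction from the quotient by `N ^ k` to the quotient by `N`. -/
def quotientPowFactor (N : Polynomial (constants F)) {k : ℕ} (hk : k ≠ 0) :
    (DiffOp F ⧸ leftIdeal (central p (N ^ k))) →+* (DiffOp F ⧸ leftIdeal (central p N)) :=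
  Ideal.Quotient.factor (S := leftIdeal (central p (N ^ k))) (T := leftIdeal (central p N))
    ((Submodule.span_singleton_le_iff_mem _ _).mpr (mem_leftIdeal.mpr
      ⟨central p (N ^ (k - 1)), by rw [← map_mul, ← pow_succ, Nat.sub_one_add_one hk]⟩))

theorem quotientPowFactor_surjective (N : Polynomial (constants F)) {k : ℕ} (hk : k ≠ 0) :
    Function.Surjective (quotientPowFactor p N hk) := by
  intro x
  obtain ⟨x, rfl⟩ := Ideal.Quotient.mk_surjective x
  exact ⟨Ideal.Quotient.mk _ x, rfl⟩

theorem quotientPowFactor_eq_zero_iff (N : Polynomial (constants F)) {k : ℕ} (hk : k ≠ 0)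
    (a : DiffOp F ⧸ leftIdeal (central p (N ^ k))) :
    quotientPowFactor p N hk a = 0 ↔ ∃ b, a = Ideal.Quotient.mk _ (central p N) * b := by
  constructor
  · intro h
    obtain ⟨a, rfl⟩ := Ideal.Quotient.mk_surjective a
    have h1 : Ideal.Quotient.mk (leftIdeal (central p N)) a = 0 := h
    obtain ⟨q, rfl⟩ := mem_leftIdeal.mp (Ideal.Quotient.eq_zero_iff_mem.mp h1)
    exact ⟨Ideal.Quotient.mk _ q, by rw [← map_mul, (commute_central p N q).eq]⟩
  · rintro ⟨b, rfl⟩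
    rw [map_mul]
    have : quotientPowFactor p N hk (Ideal.Quotient.mk _ (central p N)) =
      Ideal.Quotient.mk (leftIdeal (central p N)) (central p N) := rfl
    have h0 : Ideal.Quotient.mk (leftIdeal (central p N)) (central p N) = 0 :=
      Ideal.Quotient.eq_zero_iff_mem.mpr (Submodule.mem_span_singleton_self _)
    rw [this, h0, zero_mul]

theorem commute_mk_central (f N : Polynomial (constants F))
    (a : DiffOp F ⧸ leftIdeal (central p f)) :
    Commute (Ideal.Quotient.mk (leftIdeal (central p f)) (central p N)) a := by
  obtain ⟨a, rfl⟩ := Ideal.Quotient.mk_surjective a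
  exact (commute_central p N a).map _

theorem mk_central_pow_eq_zero (N : Polynomial (constants F)) (k : ℕ) :
    Ideal.Quotient.mk (leftIdeal (central p (N ^ k))) (central p N) ^ k = 0 := by
  rw [← map_pow, ← map_pow]
  exact Ideal.Quotient.eq_zero_iff_mem.mpr (Submodule.mem_span_singleton_self _)

variable {p} in
/-- Indecomposable modules with annihilator `N ^ k` are isomorphic. -/
theorem HasExponent.nonempty_linearEquiv {M' : Type*} [AddCommGroup M'] [Module (DiffOp F) M']
    {N : Polynomial (constants F)} {k : ℕ} (hN : Irreducible N)
    (hM : IsIndecomposableModule (DiffOp F) M) (hM' : IsIndecomposableModule (DiffOp F) M')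
    (h : HasExponent p M N k) (h' : HasExponent p M' N k) : Nonempty (M ≃ₗ[DiffOp F] M') := by
  have hk := h.ne_zero
  have := isSimpleRing_quotient p hN
  have := isArtinianRing_quotient p hN.ne_zero
  have hT := isTorsionBySet_of_hasExponent p h
  have hT' := isTorsionBySet_of_hasExponent p h'
  let := hT.module
  let := hT'.module
  have : IsScalarTower (DiffOp F) (DiffOp F ⧸ leftIdeal (central p (N ^ k))) M :=
    hT.isScalarTower
  have : IsScalarTower (DiffOp F) (DiffOp F ⧸ leftIdeal (central p (N ^ k))) M' :=
    hT'.isScalarTower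
  obtain ⟨e⟩ := (IsIndecomposableModule.quotient (I := leftIdeal (central p (N ^ k)))
    hM).nonempty_linearEquiv (IsIndecomposableModule.quotient hM')
    (baer_quotient p (pow_ne_zero k hN.ne_zero)) (commute_mk_central p _ N)
    (mk_central_pow_eq_zero p N k) (quotientPowFactor_surjective p N hk)
    (quotientPowFactor_eq_zero_iff p N hk) h.2 h'.2
  exact ⟨e.restrictScalars (DiffOp F)⟩

variable {p} in
theorem HasExponent.eq_top_of_notMem {N : Polynomial (constants F)} {k : ℕ} (hN : Irreducible N)
    (hM : IsIndecomposableModule (DiffOp F) M) (h : HasExponent p M N k)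
    {Q : Submodule (DiffOp F) M} {q : M} (hq : q ∈ Q) (hqN : ∀ x, central p N • x ≠ q) :
    Q = ⊤ := by
  have hk := h.ne_zero
  have := isSimpleRing_quotient p hN
  have := isArtinianRing_quotient p hN.ne_zero
  have hT := isTorsionBySet_of_hasExponent p h
  let := hT.module
  have : IsScalarTower (DiffOp F) (DiffOp F ⧸ leftIdeal (central p (N ^ k))) M :=
    hT.isScalarTower
  let Q' : Submodule (DiffOp F ⧸ leftIdeal (central p (N ^ k))) M :=
    { Q with
      smul_mem' := fun a x hx => by
        obtain ⟨a, rfl⟩ := Ideal.Quotient.mk_surjective a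
        exact Q.smul_mem a hx }
  have h1 : Q' = ⊤ := (IsIndecomposableModule.quotient (I := leftIdeal (central p (N ^ k)))
    hM).eq_top_of_notMem
    (baer_quotient p (pow_ne_zero k hN.ne_zero)) (commute_mk_central p _ N)
    (mk_central_pow_eq_zero p N k) (quotientPowFactor_surjective p N hk)
    (quotientPowFactor_eq_zero_iff p N hk) h.2 (q := q) hq hqN
  refine Submodule.eq_top_iff'.mpr fun x => ?_
  have : x ∈ Q' := by
    rw [h1]
    trivial
  exact this

end DiffOp

end

noncomputable section

namespace DiffOp

variable {F : Type*} [Field F] {p : ℕ} [Fact p.Prime] [CharP F p]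

/-! ### Comparison of two indecomposable operators -/

/-- Operator-linear maps are linear over `F(t)`. -/
def quotModLinearMap {L L' : DiffOp F} (f : QuotMod L →ₗ[DiffOp F] QuotMod L') :
    QuotMod L →ₗ[RatFunc F] QuotMod L' where
  toFun := f
  map_add' := map_add f
  map_smul' a x := by rw [RingHom.id_apply, ← C_smul_quot, map_smul, C_smul_quot]

theorem Equivalent.pCurvatureCharpoly_eq {L₁ L₂ : DiffOp F} (hL₁ : L₁ ≠ 0) (hL₂ : L₂ ≠ 0)
    (h : Equivalent L₁ L₂) : pCurvatureCharpoly p L₁ hL₁ = pCurvatureCharpoly p L₂ hL₂ := by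
  obtain ⟨e⟩ := h
  have := finite_quotMod L₁ hL₁
  have := finite_quotMod L₂ hL₂
  let e' : QuotMod L₁ ≃ₗ[RatFunc F] QuotMod L₂ :=
    { quotModLinearMap e.toLinearMap with
      invFun := e.symm
      left_inv := e.left_inv
      right_inv := e.right_inv }
  have hconj : e'.conj (pCurvature p L₁) = pCurvature p L₂ := by
    refine LinearMap.ext fun x => ?_
    have he : ∀ y, e' (pCurvature p L₁ y) = pCurvature p L₂ (e' y) := fun y => by
      rw [pCurvature_apply, pCurvature_apply]
      exact map_smul e _ y
    rw [LinearEquiv.conj_apply_apply, he, LinearEquiv.apply_symm_apply]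
  rw [pCurvatureCharpoly, pCurvatureCharpoly, ← hconj, LinearEquiv.charpoly_conj]

theorem isIndecomposableModule_quotient_of_hasExponent {M : Type*} [AddCommGroup M]
    [Module (DiffOp F) M] {N : Polynomial (constants F)} {k : ℕ} (hN : Irreducible N)
    (hM : IsIndecomposableModule (DiffOp F) M) (h : HasExponent p M N k)
    (W : Submodule (DiffOp F) M) : IsIndecomposableModule (DiffOp F) (M ⧸ W) := by
  intro U V hUV
  have key : ∀ U : Submodule (DiffOp F) (M ⧸ W),
      U = ⊤ ∨ U.comap W.mkQ ≤ LinearMap.range (centralSMul p M N) := by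
    intro U
    rw [or_iff_not_imp_right]
    intro hU
    obtain ⟨q, hq, hq'⟩ := SetLike.not_le_iff_exists.mp hU
    have h1 := h.eq_top_of_notMem hN hM hq fun x hx => hq' ⟨x, hx⟩
    rw [← Submodule.map_comap_eq_of_surjective W.mkQ_surjective U, h1, Submodule.map_top,
      LinearMap.range_eq_top.mpr W.mkQ_surjective]
  rcases key U with hU | hU
  · right
    have := hUV.inf_eq_bot
    rwa [hU, top_inf_eq] at this
  rcases key V with hV | hV
  · left
    have := hUV.inf_eq_bot
    rwa [hV, inf_top_eq] at this
  exfalso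
  have htop : LinearMap.range (centralSMul p M N) = ⊤ := by
    rw [eq_top_iff]
    intro x _
    have hx : W.mkQ x ∈ U ⊔ V := by
      rw [hUV.sup_eq_top]
      trivial
    obtain ⟨u, hu, v, hv, huv⟩ := Submodule.mem_sup.mp hx
    obtain ⟨u, rfl⟩ := W.mkQ_surjective u
    have h2 : x - u ∈ V.comap W.mkQ := by
      rw [Submodule.mem_comap, map_sub, ← huv, add_sub_cancel_left]
      exact hv
    have := Submodule.add_mem _ (hU hu) (hV h2)
    rwa [add_sub_cancel] at this
  obtain ⟨x, hx⟩ := h.2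
  obtain ⟨y, rfl⟩ := LinearMap.range_eq_top.mp htop x
  apply hx
  rw [centralSMul_apply, smul_smul, ← pow_succ, Nat.sub_one_add_one h.ne_zero, h.1]

theorem HasExponent.quotient_range {M : Type*} [AddCommGroup M] [Module (DiffOp F) M]
    {N : Polynomial (constants F)} {j k : ℕ} (h : HasExponent p M N k) (hj : j ≠ 0) (hjk : j < k) :
    HasExponent p (M ⧸ LinearMap.range (centralSMul p M (N ^ j))) N j := by
  constructor
  · intro x
    obtain ⟨x, rfl⟩ := Submodule.mkQ_surjective _ x
    rw [← map_smul, ← LinearMap.mem_ker, Submodule.ker_mkQ, ← map_pow]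
    exact ⟨x, rfl⟩
  · by_contra! hcon
    obtain ⟨x, hx⟩ := h.2
    have h1 := hcon (Submodule.mkQ _ x)
    rw [← map_smul, ← LinearMap.mem_ker, Submodule.ker_mkQ] at h1
    obtain ⟨y, hy⟩ := h1
    rw [centralSMul_apply, map_pow] at hy
    apply hx
    have e1 : k - 1 = (k - j) + (j - 1) := by omega
    rw [e1, pow_add, mul_smul, ← hy, smul_smul, ← pow_add, Nat.sub_add_cancel hjk.le, h.1]

theorem HasExponent.not_lt_of_finrank_eq {L L' : DiffOp F} (hL : L ≠ 0) (hL' : L' ≠ 0)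
    (hrank : Module.finrank (RatFunc F) (QuotMod L) = Module.finrank (RatFunc F) (QuotMod L'))
    (hM : IsIndecomposableModule (DiffOp F) (QuotMod L))
    (hM' : IsIndecomposableModule (DiffOp F) (QuotMod L')) {N : Polynomial (constants F)}
    {j k : ℕ} (hN : Irreducible N) (h : HasExponent p (QuotMod L) N j)
    (h' : HasExponent p (QuotMod L') N k) : ¬ j < k := by
  intro hjk
  have := finite_quotMod L hL
  have := finite_quotMod L' hL'
  obtain ⟨e⟩ := (h'.quotient_range h.ne_zero hjk).nonempty_linearEquiv hN
    (isIndecomposableModule_quotient_of_hasExponent hN hM' h' _) hM h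
  let f := e.toLinearMap ∘ₗ (LinearMap.range (centralSMul p (QuotMod L') (N ^ j))).mkQ
  have hsurj : Function.Surjective (quotModLinearMap f) :=
    e.surjective.comp (Submodule.mkQ_surjective _)
  have hinj : Function.Injective f :=
    (LinearMap.injective_iff_surjective_of_finrank_eq_finrank hrank.symm).mpr hsurj
  obtain ⟨x, hx⟩ := h'.2
  apply hx
  apply hinj
  rw [map_zero]
  change e (Submodule.mkQ _ _) = 0
  rw [LinearEquiv.map_eq_zero_iff, ← LinearMap.mem_ker, Submodule.ker_mkQ]
  refine ⟨central p N ^ (k - 1 - j) • x, ?_⟩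
  rw [centralSMul_apply, map_pow, smul_smul, ← pow_add]
  congr 2
  omega

theorem nontrivial_of_hasExponent {M : Type*} [AddCommGroup M] [Module (DiffOp F) M]
    {N : Polynomial (constants F)} {k : ℕ} (h : HasExponent p M N k) : Nontrivial M := by
  obtain ⟨x, hx⟩ := h.2
  exact ⟨x, 0, fun h0 => hx (by rw [h0, smul_zero])⟩

/-- Equal characteristic polynomials of the `p`-curvature have the same irreducible factors. -/
theorem associated_of_pCurvatureCharpoly_eq {L L' : DiffOp F} (hL : L ≠ 0) (hL' : L' ≠ 0)
    (h : pCurvatureCharpoly p L hL = pCurvatureCharpoly p L' hL')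
    {N N' : Polynomial (constants F)} (hN : Irreducible N) (hN' : Irreducible N') {j k : ℕ}
    (hj : HasExponent p (QuotMod L) N j) (hk : HasExponent p (QuotMod L') N' k) :
    Associated N N' := by
  have := finite_quotMod L hL
  have := finite_quotMod L' hL'
  by_contra hass
  have hcop : IsCoprime N N' :=
    hN.coprime_iff_not_dvd.mpr fun hd => hass (hN.associated_of_dvd hN' hd)
  set ι := (constants F).subtype
  have h1 : Polynomial.aeval (pCurvature p L) ((N ^ j).map ι) = 0 := by
    refine LinearMap.ext fun x => ?_
    rw [← central_smul, LinearMap.zero_apply, map_pow, hj.1]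
  obtain ⟨n, g, hg⟩ := LinearMap.charpoly_dvd_pow_of_aeval_eq_zero _ h1
  have h2 : ∀ x : QuotMod L', central p ((N ^ j) ^ n) • x = 0 := by
    intro x
    have e1 : central p ((N ^ j) ^ n) • x =
        Polynomial.aeval (pCurvature p L') (((N ^ j).map ι) ^ n) x := by
      rw [central_smul, Polynomial.map_pow]
    have e2 : (pCurvature p L).charpoly = (pCurvature p L').charpoly := h
    rw [e1, hg, e2, map_mul, LinearMap.aeval_self_charpoly, zero_mul, LinearMap.zero_apply]
  obtain ⟨u, v, huv⟩ := ((hcop.pow (m := j) (n := k)).pow_left (m := n))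
  have := nontrivial_of_hasExponent hk
  obtain ⟨x, hx⟩ := exists_ne (0 : QuotMod L')
  apply hx
  rw [← one_smul (DiffOp F) x, ← map_one (central p), ← huv, map_add, add_smul, map_mul, map_mul,
    mul_smul, mul_smul, h2, map_pow (central p) N', hk.1, smul_zero, smul_zero, add_zero]

theorem HasExponent.of_associated {M : Type*} [AddCommGroup M] [Module (DiffOp F) M]
    {N N' : Polynomial (constants F)} {k : ℕ} (hk : HasExponent p M N k) (h : Associated N N') :
    HasExponent p M N' k := by
  have key : ∀ n (x : M), central p N ^ n • x = 0 ↔ central p N' ^ n • x = 0 := by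
    intro n x
    have aux : ∀ {A B : Polynomial (constants F)}, A ∣ B → central p A ^ n • x = 0 →
        central p B ^ n • x = 0 := by
      rintro A _ ⟨c, rfl⟩ h0
      rw [mul_comm, map_mul, (commute_central p c _).mul_pow, mul_smul, h0, smul_zero]
    exact ⟨aux h.dvd, aux h.symm.dvd⟩
  refine ⟨fun x => (key k x).mp (hk.1 x), ?_⟩
  obtain ⟨x, hx⟩ := hk.2
  exact ⟨x, fun h0 => hx ((key _ x).mpr h0)⟩

theorem finrank_eq_of_pCurvatureCharpoly_eq {L L' : DiffOp F} (hL : L ≠ 0) (hL' : L' ≠ 0)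
    (h : pCurvatureCharpoly p L hL = pCurvatureCharpoly p L' hL') :
    Module.finrank (RatFunc F) (QuotMod L) = Module.finrank (RatFunc F) (QuotMod L') := by
  have := finite_quotMod L hL
  have := finite_quotMod L' hL'
  rw [← (pCurvature p L).charpoly_natDegree, ← (pCurvature p L').charpoly_natDegree]
  exact congrArg Polynomial.natDegree h

theorem equivalent_of_pCurvatureCharpoly_eq {L L' : DiffOp F} (hL : L ≠ 0) (hL' : L' ≠ 0)
    (hind : Indecomposable L) (hind' : Indecomposable L')
    (h : pCurvatureCharpoly p L hL = pCurvatureCharpoly p L' hL') : Equivalent L L' := by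
  have := finite_quotMod L hL
  have := finite_quotMod L' hL'
  have hrank := finrank_eq_of_pCurvatureCharpoly_eq hL hL' h
  have hM := hind.isIndecomposableModule
  have hM' := hind'.isIndecomposableModule
  rcases subsingleton_or_nontrivial (QuotMod L) with hs | hnt
  · have hs' : Subsingleton (QuotMod L') := by
      rw [← Module.finrank_zero_iff (R := RatFunc F), ← hrank, Module.finrank_zero_iff]
      exact hs
    exact ⟨0, 0, fun x => Subsingleton.elim _ _, fun x => Subsingleton.elim _ _⟩
  · have hnt' : Nontrivial (QuotMod L') := by
      rw [← Module.finrank_pos_iff (R := RatFunc F), ← hrank, Module.finrank_pos_iff]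
      exact hnt
    obtain ⟨f, hf, hfL⟩ := exists_central_annihilator p hL
    obtain ⟨f', hf', hfL'⟩ := exists_central_annihilator p hL'
    obtain ⟨N, j, hN, hj⟩ := exists_hasExponent p hM hf hfL
    obtain ⟨N', k, hN', hk⟩ := exists_hasExponent p hM' hf' hfL'
    replace hk := hk.of_associated (associated_of_pCurvatureCharpoly_eq hL hL' h hN hN' hj hk).symm
    obtain rfl : j = k := le_antisymm
      (not_lt.mp (hk.not_lt_of_finrank_eq hL' hL hrank.symm hM' hM hN hj))
      (not_lt.mp (hj.not_lt_of_finrank_eq hL hL' hrank hM hM' hN hk))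
    exact hj.nonempty_linearEquiv hN hM hM' hk

end DiffOp

end

theorem mainTheorem10 {F : Type*} [Field F] [Finite F] (p : ℕ) [Fact p.Prime] [CharP F p]
    (L₁ L₂ : DiffOp F) (hL₁ : L₁ ≠ 0) (hL₂ : L₂ ≠ 0)
    (hind₁ : DiffOp.Indecomposable L₁) (hind₂ : DiffOp.Indecomposable L₂)
    (hsep₁ : DiffOp.SeparabilityHypothesis p L₁ hL₁)
    (hsep₂ : DiffOp.SeparabilityHypothesis p L₂ hL₂) :
    DiffOp.Equivalent L₁ L₂ ↔
      DiffOp.pCurvatureCharpoly p L₁ hL₁ = DiffOp.pCurvatureCharpoly p L₂ hL₂ :=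
  ⟨fun h => h.pCurvatureCharpoly_eq hL₁ hL₂,
    fun h => DiffOp.equivalent_of_pCurvatureCharpoly_eq hL₁ hL₂ hind₁ hind₂ h⟩
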